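/- For $n\ge 0$ let $C_n$ be the cycle $(1,2,\dots,n)$ on the vertex set $[n]=\{1,\dots,n\}$, regarded as a simple graph (so $C_2$ is a single edge and $C_0,C_1$ have no edges). Let $C_n^+$ be the single cycle hypercube graph: the graph on $\pm[n]=\{-n,\dots,-1,1,\dots,n\}$ with the edges of $C_n$ between positive vertices and no edges at negative vertices. A tube is a nonempty set $t\subseteq\pm[n]$ that contains no pair $\{i,-i\}$ and induces a connected subgraph of $C_n^+$. A tubing is a set of tubes whose union contains no pair $\{i,-i\}$ and in which, for any two distinct tubes, either one is contained in the other or they are disjoint with no edge of $C_n^+$ between them. The tubings form a simplicial complex on the set of tubes. The $n$-dimensional halohedron (the cubeahedron of $C_n$, i.e. the hypercube-graph associahedron of $C_n^+$) is an $n$-dimensional simple polyhedron $H_n\subset\mathbb R^n$ whose dual simplicial complex (the sets of facets with nonempty common intersection) is isomorphic to this complex of tubings; it is determined up to combinatorial isomorphism. Let $f_k(H_n)$ be the number of nonempty $k$-dimensional faces of $H_n$, with $H_n$ itself counted as its $n$-dimensional face. **Theorem.** As formal power series in $x,y$ over $\mathbb Q$, $$\sum_{n,k\ge 0} f_k(H_n)\,x^k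 y^n \;=\; \frac{1+(2+x)y}{2\sqrt{1-2(2+x)y+x^2y^2}}+\frac12 ,$$ where the square root denotes the formal square root with constant term $1$. In particular (setting $x=0$), the numbers of vertices satisfy $$\sum_{n\ge 0} f_0(H_n)\,y^n=\frac{1+2y}{2\sqrt{1-4y}}+\frac12 .$$ These hold for every choice of realizations $H_n$. -/

import Mathlib

/-! ### Polyhedra, their faces and their dual simplicial complexes -/

section Polyhedra

variable {E : Type*} [NormedAddCommGroup E] [NormedSpace ℝ E]

/-- A polyhedron: the solution set of finitely many non-strict linear inequalities `y ≤ c x`. -/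
def IsPolyhedron (P : Set E) : Prop :=
  ∃ H : Set (StrongDual ℝ E × ℝ), H.Finite ∧ P = {x | ∀ h ∈ H, h.2 ≤ h.1 x}

/-- A (nonempty) face of `P`: the set of points of `P` at which some linear functional attains its
maximum over `P`. The zero functional shows that a nonempty `P` is a face of itself. -/
def IsFace (P F : Set E) : Prop :=
  F.Nonempty ∧ IsExposed ℝ P F

/-- The dimension of (the affine span of) a nonempty set. -/
noncomputable def faceDim (F : Set E) : ℕ :=
  Module.finrank ℝ (vectorSpan ℝ F)

/-- A facet of a full-dimensional polyhedron: a nonempty face of codimension one. -/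
def IsFacet (P F : Set E) : Prop :=
  IsFace P F ∧ faceDim F + 1 = Module.finrank ℝ E

/-- A full-dimensional simple polyhedron: every nonempty face of codimension `k` is contained in
exactly `k` facets. -/
def IsSimplePolyhedron (P : Set E) : Prop :=
  IsPolyhedron P ∧ affineSpan ℝ P = ⊤ ∧
    ∀ (F : Set E) (k : ℕ), IsFace P F → faceDim F + k = Module.finrank ℝ E →
      {G : Set E | IsFacet P G ∧ F ⊆ G}.encard = k

/-- The dual simplicial complex of `P`: the finite sets of facets of `P` that have a common point
(in `P`). As usual in face enumeration, the empty set is a face of a simplicial complex. -/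
def dualComplex (P : Set E) : Set (Finset {F : Set E // IsFacet P F}) :=
  {I | (P ∩ ⋂ F ∈ I, (F : Set E)).Nonempty}

/-- `faceCount P k` is the number of `k`-dimensional (nonempty) faces of `P`. -/
noncomputable def faceCount (P : Set E) (k : ℕ) : ℕ :=
  {F : Set E | IsFace P F ∧ faceDim F = k}.ncard

end Polyhedra

/-- Isomorphism of simplicial complexes on the base sets `α` and `β`: a bijection of the base sets
under which the faces correspond. -/
def ComplexIso {α β : Type*} (K : Set (Finset α)) (L : Set (Finset β)) : Prop :=
  ∃ e : α ≃ β, ∀ I : Finset α, I ∈ K ↔ I.map e.toEmbedding ∈ L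

/-! ### Hypercube graphs, tubes and tubings -/

/-- The vertex set `±[n]`: `Sum.inl i` is the positive vertex `i`, `Sum.inr i` is the negative
vertex `-i`. -/
abbrev SignedVertex (n : ℕ) : Type := Fin n ⊕ Fin n

/-- A face of the dual complex of the `n`-cube: a set of vertices that contains no pair `{i, -i}`
(no dashed edge). -/
def IsCubeFace {n : ℕ} (s : Finset (SignedVertex n)) : Prop :=
  ∀ i : Fin n, ¬ (Sum.inl i ∈ s ∧ Sum.inr i ∈ s)

/-- A tube of a hypercube graph: a set of vertices without dashed edges that induces a connected
(in particular nonempty) subgraph. -/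
def IsTube {n : ℕ} (G : SimpleGraph (SignedVertex n)) (t : Finset (SignedVertex n)) : Prop :=
  IsCubeFace t ∧ (G.induce (t : Set (SignedVertex n))).Connected

/-- Two tubes are weakly compatible if one is properly contained in the other or they are disjoint
and no edge of `G` joins them. -/
def WeaklyCompatible {n : ℕ} (G : SimpleGraph (SignedVertex n))
    (t u : Finset (SignedVertex n)) : Prop :=
  t ⊂ u ∨ u ⊂ t ∨ (Disjoint t u ∧ ∀ a ∈ t, ∀ b ∈ u, ¬ G.Adj a b)

/-- The tubing complex of a hypercube graph, on the set of its tubes. Its faces are the tubings: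
the sets of pairwise weakly compatible tubes whose union contains no dashed edge. -/
def tubingComplex {n : ℕ} (G : SimpleGraph (SignedVertex n)) :
    Set (Finset {t : Finset (SignedVertex n) // IsTube G t}) :=
  {T | (∀ t ∈ T, ∀ u ∈ T, t ≠ u → WeaklyCompatible G t u) ∧
    IsCubeFace (T.biUnion fun t => (t : Finset (SignedVertex n)))}

/-- The hypercube graph on `±[n]` with the edges of `G` between the positive vertices and with no
edges at the negative vertices. -/
def positiveHypercubeGraph {n : ℕ} (G : SimpleGraph (Fin n)) : SimpleGraph (SignedVertex n) :=
  SimpleGraph.sum G ⊥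

/-- The single cycle hypercube graph: the cycle `(1, 2, …, n)` on the positive vertices. It has a
single edge for `n = 2` and no edge for `n ≤ 1`. -/
def singleCycleHypercubeGraph (n : ℕ) : SimpleGraph (SignedVertex n) :=
  positiveHypercubeGraph (SimpleGraph.cycleGraph n)

/-- `P` is (a realization of) the hypercube-graph associahedron of the hypercube graph `G` on
`±[n]`: an `n`-dimensional simple polyhedron in `ℝⁿ` whose dual simplicial complex is isomorphic to
the tubing complex of `G`. -/
def IsHypercubeGraphAssociahedron {n : ℕ} (G : SimpleGraph (SignedVertex n))
    (P : Set (EuclideanSpace ℝ (Fin n))) : Prop :=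
  IsSimplePolyhedron P ∧ ComplexIso (dualComplex P) (tubingComplex G)

/-- `P` is (a realization of) the `n`-dimensional halohedron. -/
def IsHalohedron {n : ℕ} (P : Set (EuclideanSpace ℝ (Fin n))) : Prop :=
  IsHypercubeGraphAssociahedron (singleCycleHypercubeGraph n) P

/-! ### Generating functions -/

/-- The bivariate `f`-polynomial `∑_{n,k} f_k(P n) x ^ k y ^ n` of a family of polyhedra, as a formal
power series in `x = X 0` and `y = X 1`. -/
noncomputable def bivariateFPolynomial (P : (n : ℕ) → Set (EuclideanSpace ℝ (Fin n))) :
    MvPowerSeries (Fin 2) ℚ :=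
  fun m => (faceCount (P (m 1)) (m 0) : ℚ)

/-- The generating function `∑_n f_0(P n) y ^ n` of the numbers of vertices. -/
noncomputable def vertexGeneratingFunction (P : (n : ℕ) → Set (EuclideanSpace ℝ (Fin n))) :
    PowerSeries ℚ :=
  PowerSeries.mk fun n => (faceCount (P n) 0 : ℚ)

/-!
The faces of a simple polyhedron `P` of dimension `n` are counted by its dual complex
(`IsSimplePolyhedron.faceCount_eq`). Write `P` by an irredundant system of inequalities
`β i ≤ a i x`. A face is determined by the inequalities that are tight on it, and facets correspond
to single inequalities. If a face has codimension `k`, simplicity says that exactly `k` inequalities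
are tight on it, so the corresponding functionals are independent; hence every set of facets with a
common point is the set of all facets through some face, and its cardinality is the codimension of
that face.

It remains to enumerate tubings of the hypercube graph of a cycle. The tubes are the connected sets
of positive vertices and the single negative vertices, so a tubing is a tubing of the cycle together
with a set of vertices not covered by it (`ncard_tubingComplex`). This is the sum `tubingSum` in
which a vertex that is not covered has weight `c = 1 + x`. Sorting tubings by the largest tube
through a fixed vertex gives a recursion (`tubingSum_eq_add_sum`), since the tubes not inside that
tube `t` and not containing it lie in the set of vertices separated from `t`. On the cycle, `t` is
the whole cycle or an arc, and the remaining vertices form an arc again; tubings of an arc depend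
only on its length (`arc_sums_congr`), that is, they are tubings of a path.

For the generating functions, let `b` be that of the tubings of paths to which the whole path
belongs, with constant term `1`, and `Q c` that of all tubings of paths. The recursion reads
`Q c = b (1 + c y Q c)`, and `Q x = 1 + (1 + x) (b - 1)` because a tubing of a path may or may not
contain the whole path. Eliminating `Q x` gives `(1 + x) y b² - (1 + x y) b + 1 = 0`, with
discriminant `S² = 1 - 2 (2 + x) y + x² y²` and root `S = 1 + x y - 2 (1 + x) y b`. On the cycle
there are `k` arcs of length `k < n` through a given vertex, which introduces `y b'`, and
`S b' = (1 + x) b² - x b` by differentiating the quadratic equation. Together these give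
`2 F S = 1 + (2 + x) y + S` for the generating function `F` of the halohedra
(`two_mul_cycleSeries_mul_rootSeries`). The computation takes place in `ℚ[x]⟦y⟧`, which maps to
power series in two variables and, by `x = 0`, to power series in one.
-/

/-! ### Faces of polyhedra given by irredundant inequalities -/

section HalfSpaces

variable {E : Type*} [NormedAddCommGroup E] [NormedSpace ℝ E] {ι : Type*}

/-- The intersection of the half-spaces `β i ≤ a i x`. -/
def halfSpaceInter (a : ι → StrongDual ℝ E) (β : ι → ℝ) : Set E :=
  {x | ∀ i, β i ≤ a i x}

/-- The points of the polyhedron at which the inequalities indexed by `I` are equalities. -/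
def tightLocus (a : ι → StrongDual ℝ E) (β : ι → ℝ) (I : Set ι) : Set E :=
  {x | x ∈ halfSpaceInter a β ∧ ∀ i ∈ I, a i x = β i}

/-- The inequalities that are equalities on all of `F`. -/
def tightIndices (a : ι → StrongDual ℝ E) (β : ι → ℝ) (F : Set E) : Set ι :=
  {i | ∀ x ∈ F, a i x = β i}

/-- No inequality of the system can be dropped: each is violated at a point satisfying all the
others. -/
def IsIrredundant (a : ι → StrongDual ℝ E) (β : ι → ℝ) : Prop :=
  ∀ i, ∃ x, (∀ j, j ≠ i → β j ≤ a j x) ∧ a i x < β i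

variable {a : ι → StrongDual ℝ E} {β : ι → ℝ}

theorem convex_halfSpaceInter : Convex ℝ (halfSpaceInter a β) := by
  intro x hx y hy s t hs ht hst i
  have h1 := mul_le_mul_of_nonneg_left (hx i) hs
  have h2 := mul_le_mul_of_nonneg_left (hy i) ht
  have h3 : β i = s * β i + t * β i := by rw [← add_mul, hst, one_mul]
  simp only [map_add, map_smul, smul_eq_mul]
  linarith

theorem convex_tightLocus (I : Set ι) : Convex ℝ (tightLocus a β I) := by
  intro x hx y hy s t hs ht hst
  refine ⟨convex_halfSpaceInter hx.1 hy.1 hs ht hst, fun i hi => ?_⟩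
  simp only [map_add, map_smul, smul_eq_mul, hx.2 i hi, hy.2 i hi, ← add_mul, hst, one_mul]

/-- A convex part of a polyhedron has a point at which only those inequalities are equalities that
are so on the whole part. -/
theorem exists_strict_of_notMem_tightIndices [Finite ι] {F : Set E} (hF : F ⊆ halfSpaceInter a β)
    (hc : Convex ℝ F) (hne : F.Nonempty) :
    ∃ p ∈ F, ∀ i, i ∉ tightIndices a β F → β i < a i p := by
  classical
  have := Fintype.ofFinite ι
  suffices h : ∀ s : Finset ι, ∃ p ∈ F, ∀ i ∈ s, i ∉ tightIndices a β F → β i < a i p by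
    obtain ⟨p, hp, h⟩ := h Finset.univ
    exact ⟨p, hp, fun i => h i (Finset.mem_univ i)⟩
  intro s
  induction s using Finset.induction_on with
  | empty => obtain ⟨p, hp⟩ := hne; exact ⟨p, hp, by simp⟩
  | insert j s _ ih =>
    obtain ⟨p, hp, h⟩ := ih
    by_cases hj : j ∈ tightIndices a β F
    · refine ⟨p, hp, fun i hi hit => ?_⟩
      rcases Finset.mem_insert.1 hi with rfl | hi
      · exact absurd hj hit
      · exact h i hi hit
    · simp only [tightIndices, Set.mem_ofPred_eq, not_forall] at hj
      obtain ⟨q, hq, hjq⟩ := hj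
      refine ⟨(1 / 2 : ℝ) • p + (1 / 2 : ℝ) • q, hc hp hq (by norm_num) (by norm_num)
        (by norm_num), fun i hi hit => ?_⟩
      simp only [map_add, map_smul, smul_eq_mul]
      have h1 := hF hp i
      have h2 := hF hq i
      rcases Finset.mem_insert.1 hi with rfl | hi
      · have := lt_of_le_of_ne h2 (Ne.symm hjq)
        linarith
      · have := h i hi hit
        linarith

/-- From a point of the polyhedron one can move a little in every direction that does not decrease
the functionals of the inequalities tight at the point. -/
theorem exists_pos_add_smul_mem [Finite ι] {p v : E} (hp : p ∈ halfSpaceInter a β)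
    (hv : ∀ i, a i p = β i → 0 ≤ a i v) : ∃ ε : ℝ, 0 < ε ∧ p + ε • v ∈ halfSpaceInter a β := by
  have key : ∀ i, ∀ᶠ ε : ℝ in nhdsWithin 0 (Set.Ioi 0), β i ≤ a i (p + ε • v) := by
    intro i
    by_cases h : a i p = β i
    · filter_upwards [self_mem_nhdsWithin] with ε hε
      have := mul_nonneg (le_of_lt (Set.mem_Ioi.1 hε)) (hv i h)
      simp only [map_add, map_smul, smul_eq_mul]
      linarith
    · have hlt : β i < a i (p + (0 : ℝ) • v) := by
        simpa using lt_of_le_of_ne (hp i) (Ne.symm h)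
      have hcont : Continuous fun ε : ℝ => a i (p + ε • v) := by fun_prop
      exact ((hcont.tendsto 0).eventually (lt_mem_nhds hlt)).filter_mono nhdsWithin_le_nhds
        |>.mono fun _ h => h.le
  obtain ⟨ε, h, hε⟩ := ((Filter.eventually_all.2 key).and self_mem_nhdsWithin).exists
  exact ⟨ε, hε, h⟩

/-- A face is determined by the inequalities that are tight on it. -/
theorem IsFace.eq_tightLocus [Finite ι] {F : Set E} (hF : IsFace (halfSpaceInter a β) F) :
    F = tightLocus a β (tightIndices a β F) := by
  obtain ⟨l, hl⟩ := hF.2 hF.1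
  have hsub := hF.2.subset
  refine Set.Subset.antisymm (fun x hx => ⟨hsub hx, fun i hi => hi x hx⟩) fun x hx => ?_
  obtain ⟨p, hp, hps⟩ := exists_strict_of_notMem_tightIndices hsub
    (hF.2.convex convex_halfSpaceInter) hF.1
  -- `p` is relatively interior to `F`, so one can move from `p` away from `x` inside `P`.
  obtain ⟨ε, hε, hmem⟩ := exists_pos_add_smul_mem (v := p - x) (hsub hp) (by
    intro i hi
    by_cases h : i ∈ tightIndices a β F
    · simp [hi, hx.2 i h]
    · exact absurd hi (hps i h).ne')
  have hp' := hp
  rw [hl] at hp' ⊢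
  refine ⟨hx.1, fun y hy => (hp'.2 y hy).trans ?_⟩
  have := hp'.2 _ hmem
  simp only [map_add, map_smul, map_sub, smul_eq_mul] at this
  by_contra! hlt
  nlinarith [mul_pos hε (sub_pos.2 hlt)]

/-- A nonempty tight locus is exposed by minus the sum of the tight functionals. -/
theorem isFace_tightLocus [Finite ι] {I : Set ι} (hne : (tightLocus a β I).Nonempty) :
    IsFace (halfSpaceInter a β) (tightLocus a β I) := by
  classical
  have := Fintype.ofFinite ι
  refine ⟨hne, fun _ => ⟨-∑ i ∈ I.toFinset, a i, ?_⟩⟩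
  obtain ⟨p, hp⟩ := hne
  ext x
  simp only [tightLocus, Set.mem_ofPred_eq, neg_apply,
    sum_apply, neg_le_neg_iff]
  refine and_congr_right fun hx => ⟨fun h y hy => ?_, fun h i hi => ?_⟩
  · exact Finset.sum_le_sum fun i hi => by rw [h i (by simpa using hi)]; exact hy i
  · have h1 : ∑ i ∈ I.toFinset, a i x = ∑ i ∈ I.toFinset, β i := by
      refine le_antisymm ((h p hp.1).trans_eq ?_) (Finset.sum_le_sum fun i _ => hx i)
      exact Finset.sum_congr rfl fun i hi => hp.2 i (by simpa using hi)
    exact (((Finset.sum_eq_sum_iff_of_le fun i _ => hx i).1 h1.symm) i (by simpa using hi)).symm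

theorem vectorSpan_eq_ker_pi [Finite ι] {F : Set E} (hF : IsFace (halfSpaceInter a β) F) :
    vectorSpan ℝ F =
      (LinearMap.pi fun i : tightIndices a β F => (a i : E →ₗ[ℝ] ℝ)).ker := by
  refine le_antisymm ?_ fun v hv => ?_
  · rw [vectorSpan_def, Submodule.span_le]
    rintro _ ⟨x, hx, y, hy, rfl⟩
    ext i
    have h1 := i.2 x hx
    have h2 := i.2 y hy
    simp [h1, h2]
  · have hv' : ∀ i ∈ tightIndices a β F, a i v = 0 := fun i hi => congrFun hv ⟨i, hi⟩
    obtain ⟨p, hp, hps⟩ := exists_strict_of_notMem_tightIndices hF.2.subset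
      (hF.2.convex convex_halfSpaceInter) hF.1
    obtain ⟨ε, hε, hmem⟩ := exists_pos_add_smul_mem (v := v) (hF.2.subset hp) (by
      intro i hi
      by_cases h : i ∈ tightIndices a β F
      · exact (hv' i h).ge
      · exact absurd hi (hps i h).ne')
    have h2 : p + ε • v ∈ F := by
      rw [hF.eq_tightLocus]
      refine ⟨hmem, fun i hi => ?_⟩
      simp [hv' i hi, hi p hp]
    have h3 := vsub_mem_vectorSpan ℝ h2 hp
    simp only [vsub_eq_sub, add_sub_cancel_left] at h3
    exact (Submodule.smul_mem_iff _ hε.ne').1 h3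

theorem subset_tightIndices_tightLocus (I : Set ι) :
    I ⊆ tightIndices a β (tightLocus a β I) :=
  fun i hi _ hx => hx.2 i hi

theorem IsFace.subset_tightLocus_iff [Finite ι] {F : Set E} (hF : IsFace (halfSpaceInter a β) F)
    {I : Set ι} : F ⊆ tightLocus a β I ↔ I ⊆ tightIndices a β F :=
  ⟨fun h i hi _ hx => (h hx).2 i hi, fun h x hx => ⟨hF.2.subset hx, fun _ hi => h hi x hx⟩⟩

section Irredundant

variable (hirr : IsIrredundant a β) (hfull : affineSpan ℝ (halfSpaceInter a β) = ⊤)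

include hirr hfull

theorem tightIndices_halfSpaceInter : tightIndices a β (halfSpaceInter a β) = ∅ := by
  refine Set.eq_empty_of_forall_notMem fun i hi => ?_
  obtain ⟨x, -, hx⟩ := hirr i
  have h : x ∈ affineSpan ℝ (halfSpaceInter a β) := by rw [hfull]; trivial
  refine hx.ne ?_
  refine affineSpan_induction (p := fun x => a i x = β i) h hi fun c u v w hu hv hw => ?_
  simp [hu, hv, hw]

variable [Finite ι]

/-- Each inequality of an irredundant system is the only tight one at some point. -/
theorem exists_tight_only (i : ι) :
    ∃ x ∈ halfSpaceInter a β, a i x = β i ∧ ∀ j, j ≠ i → β j < a j x := by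
  have hne : (halfSpaceInter a β).Nonempty := by
    rw [Set.nonempty_iff_ne_empty]
    intro h
    rw [h, AffineSubspace.span_empty] at hfull
    exact AffineSubspace.bot_ne_top ℝ E E hfull
  obtain ⟨z, -, hz⟩ := exists_strict_of_notMem_tightIndices subset_rfl
    (convex_halfSpaceInter (a := a) (β := β)) hne
  simp only [tightIndices_halfSpaceInter hirr hfull, Set.mem_empty_iff_false, not_false_eq_true,
    true_imp_iff] at hz
  obtain ⟨x, hx, hxi⟩ := hirr i
  -- The segment from the interior point `z` to `x` crosses the hyperplane at parameter `t`.
  set t : ℝ := (a i z - β i) / (a i z - a i x) with ht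
  have hd : 0 < a i z - a i x := by linarith [hz i]
  have ht0 : 0 < t := div_pos (by linarith [hz i]) hd
  have ht1 : t < 1 := (div_lt_one hd).2 (by linarith)
  have hti : t * (a i z - a i x) = a i z - β i := div_mul_cancel₀ _ hd.ne'
  have heq : a i ((1 - t) • z + t • x) = β i := by
    simp only [map_add, map_smul, smul_eq_mul]
    linarith
  have hlt : ∀ j, j ≠ i → β j < a j ((1 - t) • z + t • x) := by
    intro j hj
    simp only [map_add, map_smul, smul_eq_mul]
    nlinarith [mul_pos (sub_pos.2 ht1) (sub_pos.2 (hz j)),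
      mul_nonneg ht0.le (sub_nonneg.2 (hx j hj))]
  refine ⟨_, fun j => ?_, heq, hlt⟩
  by_cases hj : j = i
  · subst hj; exact heq.ge
  · exact (hlt j hj).le

theorem tightIndices_tightLocus_singleton (i : ι) :
    tightIndices a β (tightLocus a β {i}) = {i} := by
  refine Set.Subset.antisymm (fun j hj => ?_) (subset_tightIndices_tightLocus _)
  obtain ⟨x, hx, hxi, hxj⟩ := exists_tight_only hirr hfull i
  by_contra hne
  exact (hxj j hne).ne' (hj x ⟨hx, by simpa using hxi⟩)

theorem isFace_tightLocus_singleton (i : ι) :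
    IsFace (halfSpaceInter a β) (tightLocus a β {i}) := by
  obtain ⟨x, hx, hxi, -⟩ := exists_tight_only hirr hfull i
  exact isFace_tightLocus ⟨x, hx, by simpa using hxi⟩

theorem functional_ne_zero (i : ι) : a i ≠ 0 := by
  intro h
  obtain ⟨x, hx, hxi, -⟩ := exists_tight_only hirr hfull i
  obtain ⟨y, -, hy⟩ := hirr i
  rw [h] at hxi hy
  simp only [zero_apply] at hxi hy
  exact hy.ne hxi

theorem vectorSpan_tightLocus_singleton (i : ι) :
    vectorSpan ℝ (tightLocus a β {i}) = (a i : E →ₗ[ℝ] ℝ).ker := by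
  rw [vectorSpan_eq_ker_pi (isFace_tightLocus_singleton hirr hfull i)]
  ext v
  simp only [LinearMap.mem_ker, funext_iff, LinearMap.pi_apply, Subtype.forall,
    tightIndices_tightLocus_singleton hirr hfull i]
  simp

variable [FiniteDimensional ℝ E]

theorem isFacet_tightLocus_singleton (i : ι) :
    IsFacet (halfSpaceInter a β) (tightLocus a β {i}) := by
  refine ⟨isFace_tightLocus_singleton hirr hfull i, ?_⟩
  rw [faceDim, vectorSpan_tightLocus_singleton hirr hfull i]
  refine Module.Dual.finrank_ker_add_one_of_ne_zero (f := (a i : E →ₗ[ℝ] ℝ)) fun h => ?_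
  exact functional_ne_zero hirr hfull i (ContinuousLinearMap.coe_injective h)

/-- Every facet is cut out by one of the inequalities. -/
theorem IsFacet.exists_eq_tightLocus {G : Set E} (hG : IsFacet (halfSpaceInter a β) G) :
    ∃ i, G = tightLocus a β {i} := by
  have hspan := vectorSpan_eq_ker_pi hG.1
  have hdim := hG.2
  have hneE : (tightIndices a β G).Nonempty := by
    by_contra hemp
    rw [Set.not_nonempty_iff_eq_empty] at hemp
    have : vectorSpan ℝ G = ⊤ := by
      rw [hspan]
      refine Submodule.eq_top_iff'.2 fun v => funext fun i => ?_
      exact absurd i.2 (by simp [hemp])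
    rw [faceDim, this, finrank_top] at hdim
    omega
  obtain ⟨i, hi⟩ := hneE
  refine ⟨i, ?_⟩
  have hfac := isFacet_tightLocus_singleton hirr hfull i
  have hsub : G ⊆ tightLocus a β {i} := hG.1.subset_tightLocus_iff.2 (by simpa using hi)
  have hle : vectorSpan ℝ G = vectorSpan ℝ (tightLocus a β {i}) := by
    refine Submodule.eq_of_le_of_finrank_eq (vectorSpan_mono ℝ hsub) ?_
    have h1 := hG.2
    have h2 := hfac.2
    rw [faceDim] at h1 h2
    omega
  refine Set.Subset.antisymm hsub fun x hx => ?_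
  rw [hG.1.eq_tightLocus]
  obtain ⟨p, hp⟩ := hG.1.1
  refine ⟨hx.1, fun j hj => ?_⟩
  have h1 : x -ᵥ p ∈ vectorSpan ℝ G := by
    rw [hle]; exact vsub_mem_vectorSpan ℝ hx (hsub hp)
  rw [hspan] at h1
  have h2 : a j (x - p) = 0 := congrFun h1 ⟨j, hj⟩
  rw [map_sub, hj p hp] at h2
  linarith

/-- The facets of the polyhedron correspond to the inequalities. -/
noncomputable def facetEquiv : ι ≃ {F : Set E // IsFacet (halfSpaceInter a β) F} :=
  Equiv.ofBijective
    (fun i => ⟨tightLocus a β {i}, isFacet_tightLocus_singleton hirr hfull i⟩) <| by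
    refine ⟨fun i j hij => ?_, fun G => ?_⟩
    · have h := congrArg (tightIndices a β) (congrArg Subtype.val hij)
      simpa [tightIndices_tightLocus_singleton hirr hfull] using h
    · obtain ⟨i, hi⟩ := G.2.exists_eq_tightLocus hirr hfull
      exact ⟨i, Subtype.ext hi.symm⟩

theorem ncard_tightIndices_add_faceDim (hs : IsSimplePolyhedron (halfSpaceInter a β)) {F : Set E}
    (hF : IsFace (halfSpaceInter a β) F) :
    (tightIndices a β F).ncard + faceDim F = Module.finrank ℝ E := by
  have hle : faceDim F ≤ Module.finrank ℝ E := Submodule.finrank_le _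
  have h := hs.2.2 F (Module.finrank ℝ E - faceDim F) hF (by omega)
  have himg : {G : Set E | IsFacet (halfSpaceInter a β) G ∧ F ⊆ G} =
      (fun i => tightLocus a β {i}) '' tightIndices a β F := by
    ext G
    constructor
    · rintro ⟨hG, hFG⟩
      obtain ⟨i, rfl⟩ := hG.exists_eq_tightLocus hirr hfull
      exact ⟨i, by simpa using hF.subset_tightLocus_iff.1 hFG, rfl⟩
    · rintro ⟨i, hi, rfl⟩
      exact ⟨isFacet_tightLocus_singleton hirr hfull i,
        hF.subset_tightLocus_iff.2 (by simpa using hi)⟩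
  have hinj : Function.Injective fun i => tightLocus a β {i} := fun i j hij =>
    (facetEquiv hirr hfull).injective (Subtype.ext hij)
  rw [himg, hinj.encard_image] at h
  have : (tightIndices a β F).ncard = Module.finrank ℝ E - faceDim F := by
    rw [Set.ncard, h, ENat.toNat_natCast]
  omega

/-- In a simple polyhedron, the functionals that are tight on a face take arbitrary values. -/
theorem pi_tightIndices_surjective (hs : IsSimplePolyhedron (halfSpaceInter a β)) {F : Set E}
    (hF : IsFace (halfSpaceInter a β) F) :
    Function.Surjective (LinearMap.pi fun i : tightIndices a β F => (a i : E →ₗ[ℝ] ℝ)) := by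
  have := Fintype.ofFinite (tightIndices a β F)
  rw [← LinearMap.range_eq_top]
  apply Submodule.eq_top_of_finrank_eq
  have h1 := LinearMap.finrank_range_add_finrank_ker
    (LinearMap.pi fun i : tightIndices a β F => (a i : E →ₗ[ℝ] ℝ))
  rw [← vectorSpan_eq_ker_pi hF] at h1
  have h2 := ncard_tightIndices_add_faceDim hirr hfull hs hF
  rw [faceDim] at h2
  rw [Module.finrank_fintype_fun_eq_card, ← Nat.card_eq_fintype_card, Nat.card_coe_set_eq]
  omega

/-- In a simple polyhedron, no further inequality becomes tight where those of `I` are tight: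
distinct sets of facets with common points have distinct intersections. -/
theorem tightIndices_tightLocus (hs : IsSimplePolyhedron (halfSpaceInter a β)) {I : Set ι}
    (hne : (tightLocus a β I).Nonempty) : tightIndices a β (tightLocus a β I) = I := by
  classical
  refine Set.Subset.antisymm (fun j hj => ?_) (subset_tightIndices_tightLocus _)
  by_contra hjI
  have hF := isFace_tightLocus hne
  obtain ⟨p, hp, hps⟩ := exists_strict_of_notMem_tightIndices hF.2.subset (convex_tightLocus I) hne
  -- Move off the hyperplane of `j` while keeping the other tight inequalities tight.
  obtain ⟨v, hv⟩ := pi_tightIndices_surjective hirr hfull hs hF (fun i => if i.1 = j then 1 else 0)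
  have hv' : ∀ i ∈ tightIndices a β (tightLocus a β I), a i v = if i = j then 1 else 0 :=
    fun i hi => congrFun hv ⟨i, hi⟩
  obtain ⟨ε, hε, hmem⟩ := exists_pos_add_smul_mem (v := v) hp.1 (by
    intro i hi
    by_cases h : i ∈ tightIndices a β (tightLocus a β I)
    · rw [hv' i h]; split_ifs <;> norm_num
    · exact absurd hi (hps i h).ne')
  have h1 : p + ε • v ∈ tightLocus a β I := by
    refine ⟨hmem, fun i hi => ?_⟩
    have hij : i ≠ j := fun h => hjI (h ▸ hi)
    have := hv' i (subset_tightIndices_tightLocus I hi)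
    rw [if_neg hij] at this
    simp [this, hp.2 i hi]
  have h2 := hj _ h1
  have h3 := hj p hp
  have h4 := hv' j hj
  simp only [map_add, map_smul, smul_eq_mul, h3, h4, if_true, mul_one] at h2
  linarith

/-- The faces of a simple polyhedron of dimension `k` correspond to the sets of tight inequalities
of cardinality `n - k`. -/
theorem faceCount_halfSpaceInter (hs : IsSimplePolyhedron (halfSpaceInter a β)) (k : ℕ) :
    faceCount (halfSpaceInter a β) k = {I : Finset ι | (tightLocus a β (I : Set ι)).Nonempty ∧
      I.card + k = Module.finrank ℝ E}.ncard := by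
  symm
  refine Set.ncard_congr (fun I _ => tightLocus a β (I : Set ι)) ?_ ?_ ?_
  · rintro I ⟨hI, hk⟩
    refine ⟨isFace_tightLocus hI, ?_⟩
    have h := ncard_tightIndices_add_faceDim hirr hfull hs (isFace_tightLocus hI)
    rw [tightIndices_tightLocus hirr hfull hs hI, Set.ncard_coe_finset] at h
    omega
  · rintro I J ⟨hI, -⟩ ⟨hJ, -⟩ hIJ
    have h := congrArg (tightIndices a β) hIJ
    rw [tightIndices_tightLocus hirr hfull hs hI, tightIndices_tightLocus hirr hfull hs hJ] at h
    exact_mod_cast h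
  · rintro F ⟨hF, hk⟩
    have hfin : (tightIndices a β F).Finite := Set.toFinite _
    refine ⟨hfin.toFinset, ⟨?_, ?_⟩, ?_⟩
    · rw [hfin.coe_toFinset, ← hF.eq_tightLocus]; exact hF.1
    · have h := ncard_tightIndices_add_faceDim hirr hfull hs hF
      rw [Set.ncard_eq_toFinset_card _ hfin] at h
      omega
    · simp only [hfin.coe_toFinset]
      exact hF.eq_tightLocus.symm

theorem mem_dualComplex_iff (I : Finset ι) :
    I.map (facetEquiv hirr hfull).toEmbedding ∈ dualComplex (halfSpaceInter a β) ↔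
      (tightLocus a β (I : Set ι)).Nonempty := by
  rw [dualComplex, Set.mem_ofPred_eq]
  refine iff_of_eq (congrArg Set.Nonempty ?_)
  ext x
  simp only [Set.mem_inter_iff, Set.mem_iInter, Finset.mem_map_equiv, tightLocus,
    Set.mem_ofPred_eq, Finset.mem_coe]
  refine and_congr_right fun hx => ⟨fun h i hi => ?_, fun h F hF => ?_⟩
  · exact (h (facetEquiv hirr hfull i) (by simpa using hi)).2 i rfl
  · obtain ⟨i, rfl⟩ := (facetEquiv hirr hfull).surjective F
    refine ⟨hx, ?_⟩
    rintro _ rfl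
    exact h _ (by simpa using hF)

end Irredundant

end HalfSpaces

theorem IsPolyhedron.exists_isIrredundant {E : Type*} [NormedAddCommGroup E] [NormedSpace ℝ E]
    {P : Set E} (hP : IsPolyhedron P) :
    ∃ H : Finset (StrongDual ℝ E × ℝ),
      P = halfSpaceInter (fun h : H => h.1.1) (fun h : H => h.1.2) ∧
      IsIrredundant (fun h : H => h.1.1) (fun h : H => h.1.2) := by
  classical
  obtain ⟨H₀, hfin, hH₀⟩ := hP
  -- A system with the fewest inequalities is irredundant.
  let p : Finset (StrongDual ℝ E × ℝ) → Prop := fun H => P = {x | ∀ h ∈ H, h.2 ≤ h.1 x}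
  have hex : ∃ H, p H := ⟨hfin.toFinset, by simpa [p] using hH₀⟩
  obtain ⟨H, hH, hmin⟩ := WellFounded.has_min (measure Finset.card).wf {H | p H} hex
  refine ⟨H, ?_, ?_⟩
  · rw [show P = _ from hH]
    ext x
    simp [halfSpaceInter]
  · rintro ⟨h, hh⟩
    by_contra! hcon
    refine hmin (H.erase h) ?_ (Finset.card_erase_lt_of_mem hh)
    refine (show P = _ from hH).trans (Set.Subset.antisymm ?_ ?_)
    · exact fun x hx g hg => hx g (Finset.mem_of_mem_erase hg)
    · intro x hx g hg
      have h1 := hcon x fun j hj => hx j.1 (Finset.mem_erase.2 ⟨fun e => hj (Subtype.ext e), j.2⟩)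
      by_cases hgh : g = h
      · subst hgh; exact h1
      · exact hx g (Finset.mem_erase.2 ⟨hgh, hg⟩)

/-- The faces of a simple polyhedron are counted by its dual complex: the faces of dimension `k`
correspond to the faces of the complex with `n - k` vertices. -/
theorem IsSimplePolyhedron.faceCount_eq {E : Type*} [NormedAddCommGroup E] [NormedSpace ℝ E]
    [FiniteDimensional ℝ E] {P : Set E} (hP : IsSimplePolyhedron P) {β : Type*}
    {L : Set (Finset β)} (hL : ComplexIso (dualComplex P) L) (k : ℕ) :
    faceCount P k = {I : Finset β | I ∈ L ∧ I.card + k = Module.finrank ℝ E}.ncard := by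
  obtain ⟨H, rfl, hirr⟩ := hP.1.exists_isIrredundant
  obtain ⟨e, he⟩ := hL
  rw [faceCount_halfSpaceInter hirr hP.2.1 hP]
  set φ := (facetEquiv hirr hP.2.1).trans e with hφ
  have key : ∀ I : Finset H, I.map φ.toEmbedding ∈ L ↔ (tightLocus (fun h : H => h.1.1)
      (fun h : H => h.1.2) (I : Set H)).Nonempty := by
    intro I
    rw [← mem_dualComplex_iff hirr hP.2.1, he, Finset.map_map]
    rfl
  refine Set.ncard_congr (fun I _ => I.map φ.toEmbedding) ?_ ?_ ?_
  · rintro I ⟨h1, h2⟩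
    exact ⟨(key I).2 h1, by rwa [Finset.card_map]⟩
  · intro I J _ _ h
    exact Finset.map_injective _ h
  · rintro J ⟨h1, h2⟩
    have hJ : (J.map φ.symm.toEmbedding).map φ.toEmbedding = J := by
      ext; simp
    exact ⟨J.map φ.symm.toEmbedding, ⟨(key _).1 (by rwa [hJ]), by rwa [Finset.card_map]⟩, hJ⟩

/-! ### Connected sets of vertices and their cuts -/

section Tubings

variable {V : Type*} {G : SimpleGraph V}

theorem SimpleGraph.Connected.exists_adj_of_ssubset {t A : Finset V}
    (ht : (G.induce (t : Set V)).Connected) (hA : A ⊆ t) (hne : A.Nonempty) (hAt : A ≠ t) :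
    ∃ a ∈ A, ∃ b ∈ t, b ∉ A ∧ G.Adj a b := by
  by_contra! hcon
  obtain ⟨a, ha⟩ := hne
  obtain ⟨b, hb, hbA⟩ := Finset.exists_of_ssubset (lt_of_le_of_ne hA hAt)
  have key : ∀ y, (G.induce (t : Set V)).Reachable ⟨a, hA ha⟩ y → y.1 ∈ A := by
    intro y hy
    rw [SimpleGraph.reachable_iff_reflTransGen] at hy
    induction hy with
    | refl => exact ha
    | tail _ hxy ih =>
      by_contra hyA
      exact hcon _ ih _ (Finset.mem_coe.1 (Subtype.prop _)) hyA hxy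
  exact hbA (key ⟨b, hb⟩ (ht.preconnected _ _))

/-- A nonempty set of vertices is connected if every partition of it into two nonempty parts is
crossed by an edge. -/
theorem SimpleGraph.connected_induce_of_exists_adj {t : Finset V} (hne : t.Nonempty)
    (h : ∀ A ⊆ t, A.Nonempty → A ≠ t → ∃ a ∈ A, ∃ b ∈ t, b ∉ A ∧ G.Adj a b) :
    (G.induce (t : Set V)).Connected := by
  classical
  have : Nonempty (t : Set V) := hne.to_subtype
  refine ⟨fun x y => ?_⟩
  let A : Finset V := {v ∈ t | ∃ hv : v ∈ t, (G.induce (t : Set V)).Reachable x ⟨v, hv⟩}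
  have hAt : A = t := by
    by_contra hA
    obtain ⟨a, ha, b, hb, hbA, hab⟩ := h A (Finset.filter_subset _ _)
      ⟨x, Finset.mem_filter.2 ⟨x.2, x.2, .refl _⟩⟩ hA
    obtain ⟨hat, _, hxa⟩ := Finset.mem_filter.1 ha
    have hadj : (G.induce (t : Set V)).Adj ⟨a, hat⟩ ⟨b, hb⟩ := hab
    exact hbA (Finset.mem_filter.2 ⟨hb, hb, hxa.trans hadj.reachable⟩)
  have hy : y.1 ∈ A := by rw [hAt]; exact y.2
  exact (Finset.mem_filter.1 hy).2.2

theorem SimpleGraph.Connected.finset_nonempty {t : Finset V}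
    (ht : (G.induce (t : Set V)).Connected) : t.Nonempty := by
  obtain ⟨x⟩ := ht.nonempty
  exact ⟨x.1, x.2⟩

/-! ### Tubings of a graph -/

/-- Compatibility of tubes: nested, or disjoint and not joined by an edge. -/
def TubesCompatible (G : SimpleGraph V) (t u : Finset V) : Prop :=
  t ⊂ u ∨ u ⊂ t ∨ (Disjoint t u ∧ ∀ a ∈ t, ∀ b ∈ u, ¬ G.Adj a b)

theorem TubesCompatible.symm {t u : Finset V} (h : TubesCompatible G t u) :
    TubesCompatible G u t := by
  rcases h with h | h | ⟨h1, h2⟩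
  · exact .inr (.inl h)
  · exact .inl h
  · exact .inr (.inr ⟨h1.symm, fun a ha b hb hab => h2 b hb a ha hab.symm⟩)

/-- A tubing of a graph: a set of pairwise compatible tubes, where a tube is a set of vertices that
induces a connected subgraph; connected components, and hence the whole vertex set of a connected
graph, are allowed as tubes. -/
structure IsGraphTubing (G : SimpleGraph V) (T : Finset (Finset V)) : Prop where
  connected : ∀ t ∈ T, (G.induce (t : Set V)).Connected
  compatible : ∀ t ∈ T, ∀ u ∈ T, t ≠ u → TubesCompatible G t u

theorem IsGraphTubing.subset {T T' : Finset (Finset V)} (h : IsGraphTubing G T) (hT : T' ⊆ T) :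
    IsGraphTubing G T' :=
  ⟨fun t ht => h.connected t (hT ht), fun t ht u hu => h.compatible t (hT ht) u (hT hu)⟩

variable [DecidableEq V]

theorem IsGraphTubing.union {T T' : Finset (Finset V)} (h : IsGraphTubing G T)
    (h' : IsGraphTubing G T') (hc : ∀ t ∈ T, ∀ u ∈ T', TubesCompatible G t u) :
    IsGraphTubing G (T ∪ T') := by
  refine ⟨fun t ht => ?_, fun t ht u hu htu => ?_⟩
  · rcases Finset.mem_union.1 ht with ht | ht
    exacts [h.connected t ht, h'.connected t ht]
  · rcases Finset.mem_union.1 ht with ht | ht <;> rcases Finset.mem_union.1 hu with hu | hu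
    exacts [h.compatible t ht u hu htu, hc t ht u hu, (hc u hu t ht).symm,
      h'.compatible t ht u hu htu]

/-- The set of vertices covered by a set of tubes. -/
def covered (T : Finset (Finset V)) : Finset V := T.biUnion id

theorem mem_covered {T : Finset (Finset V)} {v : V} : v ∈ covered T ↔ ∃ t ∈ T, v ∈ t := by
  simp [covered]

theorem covered_union (T T' : Finset (Finset V)) :
    covered (T ∪ T') = covered T ∪ covered T' :=
  Finset.union_biUnion

theorem covered_subset {T : Finset (Finset V)} {W : Finset V} (h : ∀ t ∈ T, t ⊆ W) :
    covered T ⊆ W :=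
  Finset.biUnion_subset.2 h

/-- A tube of a tubing is not covered by its proper subtubes: it is connected, while the maximal
proper subtubes are pairwise not joined by edges. -/
theorem IsGraphTubing.exists_mem_forall_ssubset_notMem {T : Finset (Finset V)}
    (hT : IsGraphTubing G T) {t : Finset V} (ht : t ∈ T) :
    ∃ v ∈ t, ∀ u ∈ T, u ⊂ t → v ∉ u := by
  by_contra! hcon
  obtain ⟨v, hv⟩ := (hT.connected t ht).finset_nonempty
  obtain ⟨u₀, hu₀, hu₀t, -⟩ := hcon v hv
  -- A maximal proper subtube `u` is left by an edge inside `t`, whose end no subtube can cover.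
  obtain ⟨u, hu, hmax⟩ := (T.filter (· ⊂ t)).exists_max_image Finset.card
    ⟨u₀, Finset.mem_filter.2 ⟨hu₀, hu₀t⟩⟩
  obtain ⟨huT, hut⟩ := Finset.mem_filter.1 hu
  obtain ⟨a, ha, b, hb, hbu, hab⟩ := (hT.connected t ht).exists_adj_of_ssubset hut.1
    (hT.connected u huT).finset_nonempty hut.ne
  obtain ⟨w, hw, hwt, hbw⟩ := hcon b hb
  have huw : u ≠ w := fun h => hbu (h ▸ hbw)
  rcases hT.compatible u huT w hw huw with h | h | h
  · exact absurd (hmax w (Finset.mem_filter.2 ⟨hw, hwt⟩)) (not_le.2 (Finset.card_lt_card h))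
  · exact hbu (h.1 hbw)
  · exact h.2 a ha b hbw hab

/-- A tubing has at most as many tubes as it covers vertices. -/
theorem IsGraphTubing.card_le {T : Finset (Finset V)} (hT : IsGraphTubing G T) :
    T.card ≤ (covered T).card := by
  rcases T.eq_empty_or_nonempty with rfl | ⟨t₀, ht₀⟩
  · simp
  have : Nonempty V := (hT.connected t₀ ht₀).finset_nonempty.to_type
  have h := fun t (ht : t ∈ T) => hT.exists_mem_forall_ssubset_notMem ht
  choose! φ hφt hφ using h
  refine Finset.card_le_card_of_injOn φ (fun t ht => mem_covered.2 ⟨t, ht, hφt t ht⟩) ?_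
  intro t ht u hu htu
  by_contra hne
  rcases hT.compatible t ht u hu hne with h | h | h
  · exact hφ u hu t ht h (htu ▸ hφt t ht)
  · exact hφ t ht u hu h (htu ▸ hφt u hu)
  · exact Finset.disjoint_left.1 h.1 (hφt t ht) (htu ▸ hφt u hu)

open scoped Classical in
/-- The tubings of `G` all of whose tubes lie in `W`. -/
noncomputable def tubingsIn (G : SimpleGraph V) (W : Finset V) : Finset (Finset (Finset V)) :=
  {T ∈ W.powerset.powerset | IsGraphTubing G T}

omit [DecidableEq V] in
theorem mem_tubingsIn {W : Finset V} {T : Finset (Finset V)} :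
    T ∈ tubingsIn G W ↔ IsGraphTubing G T ∧ ∀ t ∈ T, t ⊆ W := by
  simp [tubingsIn, Finset.subset_iff (s₁ := T), and_comm]

open scoped Classical in
/-- The tubes of `G` contained in `W` that contain `v`. -/
noncomputable def tubesAt (G : SimpleGraph V) (W : Finset V) (v : V) : Finset (Finset V) :=
  {t ∈ W.powerset | v ∈ t ∧ (G.induce (t : Set V)).Connected}

theorem mem_tubesAt {W : Finset V} {v : V} {t : Finset V} :
    t ∈ tubesAt G W v ↔ t ⊆ W ∧ v ∈ t ∧ (G.induce (t : Set V)).Connected := by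
  simp [tubesAt]

open scoped Classical in
/-- The vertices of `W` that are neither in `t` nor adjacent to a vertex of `t`. -/
noncomputable def separatedFrom (G : SimpleGraph V) (W t : Finset V) : Finset V :=
  {w ∈ W | w ∉ t ∧ ∀ a ∈ t, ¬ G.Adj a w}

theorem mem_separatedFrom {W t : Finset V} {w : V} :
    w ∈ separatedFrom G W t ↔ w ∈ W ∧ w ∉ t ∧ ∀ a ∈ t, ¬ G.Adj a w := by
  simp [separatedFrom]

theorem disjoint_separatedFrom (W t : Finset V) : Disjoint t (separatedFrom G W t) :=
  Finset.disjoint_left.2 fun _ h h' => (mem_separatedFrom.1 h').2.1 h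

theorem covered_eq_of_mem {t : Finset V} {T : Finset (Finset V)} (hT : T ∈ tubingsIn G t)
    (ht : t ∈ T) : covered T = t :=
  (covered_subset (mem_tubingsIn.1 hT).2).antisymm fun _ hv => mem_covered.2 ⟨t, ht, hv⟩

theorem IsGraphTubing.insert {t : Finset V} {T : Finset (Finset V)} (hT : IsGraphTubing G T)
    (hsub : ∀ u ∈ T, u ⊆ t) (ht : (G.induce (t : Set V)).Connected) :
    IsGraphTubing G (insert t T) := by
  have hc : ∀ u ∈ T, u ≠ t → TubesCompatible G u t := fun u hu hut =>
    .inl (lt_of_le_of_ne (hsub u hu) hut)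
  refine ⟨fun u hu => ?_, fun u hu w hw huw => ?_⟩
  · rcases Finset.mem_insert.1 hu with rfl | hu
    exacts [ht, hT.connected u hu]
  · rcases Finset.mem_insert.1 hu with rfl | hu' <;> rcases Finset.mem_insert.1 hw with rfl | hw'
    exacts [absurd rfl huw, (hc w hw' huw.symm).symm, hc u hu' huw, hT.compatible u hu' w hw' huw]

theorem card_lt_of_notMem {t : Finset V} {T : Finset (Finset V)} (hT : T ∈ tubingsIn G t)
    (ht : (G.induce (t : Set V)).Connected) (hn : t ∉ T) : T.card < t.card := by
  have hT' := mem_tubingsIn.1 hT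
  have h := (hT'.1.insert hT'.2 ht).card_le
  rw [Finset.card_insert_of_notMem hn] at h
  refine h.trans (Finset.card_le_card (covered_subset fun u hu => ?_))
  rcases Finset.mem_insert.1 hu with rfl | hu
  exacts [subset_rfl, hT'.2 u hu]

/-- The union of the tubes through `v`, which form a chain: the largest tube through `v`, if there
is one. -/
def topTube (v : V) (T : Finset (Finset V)) : Finset V := covered {t ∈ T | v ∈ t}

theorem subset_topTube {v : V} {T : Finset (Finset V)} {u : Finset V} (hu : u ∈ T) (hv : v ∈ u) :
    u ⊆ topTube v T :=
  fun _ hw => mem_covered.2 ⟨u, Finset.mem_filter.2 ⟨hu, hv⟩, hw⟩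

theorem topTube_eq {v : V} {T : Finset (Finset V)} {t : Finset V} (ht : t ∈ T) (hv : v ∈ t)
    (hmax : ∀ u ∈ T, v ∈ u → u ⊆ t) : topTube v T = t :=
  (covered_subset fun u hu => hmax u (Finset.mem_filter.1 hu).1 (Finset.mem_filter.1 hu).2).antisymm
    (subset_topTube ht hv)

theorem IsGraphTubing.topTube_mem {v : V} {T : Finset (Finset V)} (hT : IsGraphTubing G T)
    (hv : v ∈ covered T) : topTube v T ∈ T ∧ v ∈ topTube v T := by
  obtain ⟨t₀, ht₀, hvt₀⟩ := mem_covered.1 hv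
  obtain ⟨t, ht, hmax⟩ := (T.filter (v ∈ ·)).exists_max_image Finset.card
    ⟨t₀, Finset.mem_filter.2 ⟨ht₀, hvt₀⟩⟩
  obtain ⟨htT, hvt⟩ := Finset.mem_filter.1 ht
  have heq : topTube v T = t := by
    refine topTube_eq htT hvt fun u hu hvu => ?_
    by_contra hsub
    have hne : t ≠ u := by rintro rfl; exact hsub subset_rfl
    rcases hT.compatible t htT u hu hne with h | h | h
    · exact absurd (hmax u (Finset.mem_filter.2 ⟨hu, hvu⟩)) (not_le.2 (Finset.card_lt_card h))
    · exact hsub h.1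
    · exact Finset.disjoint_left.1 h.1 hvt hvu
  rw [heq]
  exact ⟨htT, hvt⟩

/-- A tubing with largest tube `t` through `v` consists of a tubing of `t` containing `t` and a
tubing of the set of vertices separated from `t`. -/
theorem sum_tubingsIn_topTube_eq {M : Type*} [AddCommMonoid M] {W : Finset V} {v : V}
    {t : Finset V} (ht : t ∈ tubesAt G W v) (f : Finset (Finset V) → M) :
    ∑ T ∈ tubingsIn G W with v ∈ covered T ∧ topTube v T = t, f T =
      ∑ T ∈ {T ∈ tubingsIn G t | t ∈ T} ×ˢ tubingsIn G (separatedFrom G W t), f (T.1 ∪ T.2) := by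
  obtain ⟨htW, hvt, htc⟩ := mem_tubesAt.1 ht
  have hdisj : ∀ T₂ ∈ tubingsIn G (separatedFrom G W t), ∀ u ∈ T₂, ¬ u ⊆ t := by
    intro T₂ hT₂ u hu hut
    obtain ⟨hT₂, hT₂s⟩ := mem_tubingsIn.1 hT₂
    obtain ⟨w, hw⟩ := (hT₂.connected u hu).finset_nonempty
    exact Finset.disjoint_left.1 (disjoint_separatedFrom W t) (hut hw) (hT₂s u hu hw)
  refine Finset.sum_bij' (fun T _ => (T.filter (· ⊆ t), T.filter (¬ · ⊆ t)))
    (fun T _ => T.1 ∪ T.2) ?_ ?_ ?_ ?_ ?_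
  · intro T hT
    obtain ⟨hT, hv, htop⟩ := Finset.mem_filter.1 hT
    obtain ⟨hT, hTW⟩ := mem_tubingsIn.1 hT
    have htT : t ∈ T := htop ▸ (hT.topTube_mem hv).1
    refine Finset.mem_product.2 ⟨Finset.mem_filter.2 ⟨mem_tubingsIn.2
      ⟨hT.subset (Finset.filter_subset _ _), fun u hu => (Finset.mem_filter.1 hu).2⟩,
      Finset.mem_filter.2 ⟨htT, subset_rfl⟩⟩, mem_tubingsIn.2
      ⟨hT.subset (Finset.filter_subset _ _), fun u hu w hw => ?_⟩⟩
    obtain ⟨huT, hut⟩ := Finset.mem_filter.1 hu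
    have hne : t ≠ u := by rintro rfl; exact hut subset_rfl
    rcases hT.compatible t htT u huT hne with h | h | h
    · exact absurd (htop ▸ subset_topTube huT (h.1 hvt)) hut
    · exact absurd h.1 hut
    · exact mem_separatedFrom.2 ⟨hTW u huT hw, fun hwt => Finset.disjoint_left.1 h.1 hwt hw,
        fun a ha => h.2 a ha w hw⟩
  · intro T hT
    obtain ⟨hT₁, hT₂⟩ := Finset.mem_product.1 hT
    obtain ⟨hT₁, htT₁⟩ := Finset.mem_filter.1 hT₁
    obtain ⟨hT₁, hT₁s⟩ := mem_tubingsIn.1 hT₁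
    obtain ⟨hT₂, hT₂s⟩ := mem_tubingsIn.1 hT₂
    have htT : t ∈ T.1 ∪ T.2 := Finset.mem_union_left _ htT₁
    refine Finset.mem_filter.2 ⟨mem_tubingsIn.2 ⟨hT₁.union hT₂ fun u hu w hw => .inr (.inr
      ⟨Finset.disjoint_of_subset_left (hT₁s u hu) (Finset.disjoint_of_subset_right (hT₂s w hw)
        (disjoint_separatedFrom W t)), fun a ha b hb =>
        (mem_separatedFrom.1 (hT₂s w hw hb)).2.2 a (hT₁s u hu ha)⟩), fun u hu => ?_⟩,
      mem_covered.2 ⟨t, htT, hvt⟩, topTube_eq htT hvt fun u hu hvu => ?_⟩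
    · rcases Finset.mem_union.1 hu with hu | hu
      · exact (hT₁s u hu).trans htW
      · exact (hT₂s u hu).trans fun w hw => (mem_separatedFrom.1 hw).1
    · rcases Finset.mem_union.1 hu with hu | hu
      · exact hT₁s u hu
      · exact absurd hvt (mem_separatedFrom.1 (hT₂s u hu hvu)).2.1
  · intro T _
    exact Finset.filter_union_filter_not_eq _ _
  · intro T hT
    obtain ⟨hT₁, hT₂⟩ := Finset.mem_product.1 hT
    have h1 : ∀ u ∈ T.1, u ⊆ t := (mem_tubingsIn.1 (Finset.mem_filter.1 hT₁).1).2
    have h2 := hdisj _ hT₂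
    refine Prod.ext ?_ ?_
    · simp only [Finset.filter_union, Finset.filter_true_of_mem h1, Finset.filter_false_of_mem h2,
        Finset.union_empty]
    · have h1' : ∀ u ∈ T.1, ¬ ¬ u ⊆ t := fun u hu => not_not.2 (h1 u hu)
      simp only [Finset.filter_union, Finset.filter_true_of_mem h2, Finset.filter_false_of_mem h1',
        Finset.empty_union]
  · intro T _
    rw [Finset.filter_union_filter_not_eq]

/-! ### Weighted enumeration of tubings -/

variable {R : Type*} [CommRing R]

/-- The generating function of the tubings in `W`: a tubing with `m` tubes that covers `r` vertices
has weight `x ^ (r - m)`, and each of the vertices of `W` that it does not cover has weight `c`. The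
subtraction is never truncated, by `IsGraphTubing.card_le`. -/
noncomputable def tubingSum (G : SimpleGraph V) (x c : R) (W : Finset V) : R :=
  ∑ T ∈ tubingsIn G W, x ^ ((covered T).card - T.card) * c ^ (W.card - (covered T).card)

/-- The generating function of the tubings in `t` to which `t` belongs, by the number of vertices of
`t` minus the number of tubes. -/
noncomputable def topTubingSum (G : SimpleGraph V) (x : R) (t : Finset V) : R :=
  ∑ T ∈ tubingsIn G t with t ∈ T, x ^ (t.card - T.card)

theorem tubingSum_empty (x c : R) : tubingSum G x c ∅ = 1 := by
  have h : tubingsIn G ∅ = {∅} := by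
    ext T
    rw [mem_tubingsIn, Finset.mem_singleton]
    constructor
    · rintro ⟨hT, h⟩
      refine Finset.eq_empty_of_forall_notMem fun t ht => ?_
      exact (hT.connected t ht).finset_nonempty.ne_empty (Finset.subset_empty.1 (h t ht))
    · rintro rfl
      exact ⟨⟨by simp, by simp⟩, by simp⟩
  simp [tubingSum, h, covered]

/-- The tubings of a tube `t` come in pairs, with and without `t`. -/
theorem tubingSum_self_eq {t : Finset V} (ht : (G.induce (t : Set V)).Connected) (x : R) :
    tubingSum G x x t = (1 + x) * topTubingSum G x t := by
  have hw : ∀ T ∈ tubingsIn G t, x ^ ((covered T).card - T.card) * x ^ (t.card - (covered T).card)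
      = x ^ (t.card - T.card) := by
    intro T hT
    have h1 := (mem_tubingsIn.1 hT).1.card_le
    have h2 := Finset.card_le_card (covered_subset (mem_tubingsIn.1 hT).2)
    rw [← pow_add]
    congr 1
    omega
  rw [tubingSum, Finset.sum_congr rfl hw, ← Finset.sum_filter_add_sum_filter_not _ (t ∈ ·),
    add_mul, one_mul, topTubingSum, Finset.mul_sum]
  congr 1
  refine Finset.sum_bij' (fun T _ => insert t T) (fun T _ => T.erase t) ?_ ?_ ?_ ?_ ?_
  · intro T hT
    obtain ⟨hT, -⟩ := Finset.mem_filter.1 hT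
    obtain ⟨hT, hTt⟩ := mem_tubingsIn.1 hT
    refine Finset.mem_filter.2 ⟨mem_tubingsIn.2 ⟨hT.insert hTt ht, fun u hu => ?_⟩,
      Finset.mem_insert_self _ _⟩
    rcases Finset.mem_insert.1 hu with rfl | hu
    exacts [subset_rfl, hTt u hu]
  · intro T hT
    obtain ⟨hT, -⟩ := Finset.mem_filter.1 hT
    obtain ⟨hT, hTt⟩ := mem_tubingsIn.1 hT
    exact Finset.mem_filter.2 ⟨mem_tubingsIn.2 ⟨hT.subset (Finset.erase_subset _ _),
      fun u hu => hTt u (Finset.mem_of_mem_erase hu)⟩, Finset.notMem_erase _ _⟩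
  · intro T hT
    exact Finset.erase_insert (Finset.mem_filter.1 hT).2
  · intro T hT
    exact Finset.insert_erase (Finset.mem_filter.1 hT).2
  · intro T hT
    obtain ⟨hT, hn⟩ := Finset.mem_filter.1 hT
    have h := card_lt_of_notMem hT ht hn
    rw [Finset.card_insert_of_notMem hn, ← pow_succ']
    congr 1
    omega

/-- Recursion for the tubings in `W`, according to the largest tube `t` through a vertex `v`. The
exponent of `c` is the number of vertices of `W` outside `t` that are adjacent to `t`; no tube can
cover them. -/
theorem tubingSum_eq_add_sum {W : Finset V} {v : V} (hv : v ∈ W) (x c : R) :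
    tubingSum G x c W = c * tubingSum G x c (W.erase v) +
      ∑ t ∈ tubesAt G W v, topTubingSum G x t *
        (c ^ (W.card - t.card - (separatedFrom G W t).card) *
          tubingSum G x c (separatedFrom G W t)) := by
  rw [tubingSum, ← Finset.sum_filter_not_add_sum_filter _ (v ∈ covered ·)]
  congr 1
  · have hset : {T ∈ tubingsIn G W | v ∉ covered T} = tubingsIn G (W.erase v) := by
      ext T
      simp only [Finset.mem_filter, mem_tubingsIn, and_assoc, mem_covered, not_exists, not_and,
        Finset.subset_erase]
      exact and_congr_right fun _ => forall₂_and.symm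
    rw [hset, tubingSum, Finset.mul_sum]
    refine Finset.sum_congr rfl fun T hT => ?_
    have h := Finset.card_le_card (covered_subset (mem_tubingsIn.1 hT).2)
    have h' := Finset.card_erase_add_one hv
    rw [show W.card - (covered T).card = (W.erase v).card - (covered T).card + 1 by omega]
    ring
  · rw [← Finset.sum_fiberwise_of_maps_to (s := {T ∈ tubingsIn G W | v ∈ covered T})
      (t := tubesAt G W v) (g := topTube v)]
    · refine Finset.sum_congr rfl fun t ht => ?_
      rw [Finset.filter_filter, sum_tubingsIn_topTube_eq ht, Finset.sum_product, topTubingSum,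
        tubingSum, Finset.sum_mul]
      refine Finset.sum_congr rfl fun T₁ hT₁ => ?_
      rw [Finset.mul_sum, Finset.mul_sum]
      refine Finset.sum_congr rfl fun T₂ hT₂ => ?_
      obtain ⟨hT₁, htT₁⟩ := Finset.mem_filter.1 hT₁
      have hcov := covered_eq_of_mem hT₁ htT₁
      obtain ⟨hT₁, hT₁s⟩ := mem_tubingsIn.1 hT₁
      obtain ⟨hT₂, hT₂s⟩ := mem_tubingsIn.1 hT₂
      have hd : Disjoint t (covered T₂) :=
        Finset.disjoint_of_subset_right (covered_subset hT₂s) (disjoint_separatedFrom W t)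
      have hdT : Disjoint T₁ T₂ := by
        refine Finset.disjoint_left.2 fun u hu hu' => ?_
        obtain ⟨w, hw⟩ := (hT₁.connected u hu).finset_nonempty
        exact Finset.disjoint_left.1 hd (hT₁s u hu hw) (mem_covered.2 ⟨u, hu', hw⟩)
      have h1 := hT₁.card_le
      have h2 := hT₂.card_le
      have h3 := Finset.card_le_card (covered_subset hT₂s)
      have h4 : t.card + (separatedFrom G W t).card ≤ W.card := by
        rw [← Finset.card_union_of_disjoint (disjoint_separatedFrom W t)]
        exact Finset.card_le_card (Finset.union_subset (mem_tubesAt.1 ht).1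
          fun w hw => (mem_separatedFrom.1 hw).1)
      simp only
      rw [covered_union, hcov, Finset.card_union_of_disjoint hd, Finset.card_union_of_disjoint hdT]
      rw [hcov] at h1
      rw [show t.card + (covered T₂).card - (T₁.card + T₂.card) =
        (t.card - T₁.card) + ((covered T₂).card - T₂.card) by omega,
        show W.card - (t.card + (covered T₂).card) = (W.card - t.card - (separatedFrom G W t).card)
        + ((separatedFrom G W t).card - (covered T₂).card) by omega]
      ring
    · intro T hT
      obtain ⟨hT, hvT⟩ := Finset.mem_filter.1 hT
      obtain ⟨hT, hTW⟩ := mem_tubingsIn.1 hT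
      have h := hT.topTube_mem hvT
      exact mem_tubesAt.2 ⟨hTW _ h.1, h.2, hT.connected _ h.1⟩

end Tubings

/-! ### Arcs of a cycle -/

section Arcs

variable {n : ℕ}

theorem Fin.val_sub_eq_ite (a b : Fin n) :
    (a - b).val = if b.val ≤ a.val then a.val - b.val else n + a.val - b.val := by
  rw [Fin.val_sub]
  have ha := a.2
  have hb := b.2
  split_ifs with h
  · rw [show n - b.val + a.val = a.val - b.val + n by omega, Nat.add_mod_right,
      Nat.mod_eq_of_lt (by omega)]
  · rw [Nat.mod_eq_of_lt (by omega)]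
    omega

variable [NeZero n]

theorem Fin.val_sub_eq_ite_sub (s a b : Fin n) :
    (a - b).val = if (b - s).val ≤ (a - s).val then (a - s).val - (b - s).val
      else n + (a - s).val - (b - s).val := by
  rw [← Fin.val_sub_eq_ite, sub_sub_sub_cancel_right]

/-- The arc of `k` consecutive vertices of the cycle on `Fin n` that starts at `s`. -/
def arc (s : Fin n) (k : ℕ) : Finset (Fin n) := {v | (v - s).val < k}

omit [NeZero n] in
theorem mem_arc {s v : Fin n} {k : ℕ} : v ∈ arc s k ↔ (v - s).val < k := by
  simp [arc]

/-- The vertex reached from `s` by `j` steps around the cycle. -/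
def arcPoint (s : Fin n) (j : ℕ) : Fin n := s + Fin.ofNat n j

theorem arcPoint_sub_val (s : Fin n) {j : ℕ} (hj : j < n) : (arcPoint s j - s).val = j := by
  simp [arcPoint, Fin.ofNat, Nat.mod_eq_of_lt hj]

theorem arcPoint_val_sub (s v : Fin n) : arcPoint s (v - s).val = v := by
  simp [arcPoint]

theorem eq_arcPoint_iff {s v : Fin n} {j : ℕ} (hj : j < n) :
    v = arcPoint s j ↔ (v - s).val = j := by
  constructor
  · rintro rfl; exact arcPoint_sub_val s hj
  · rintro rfl; exact (arcPoint_val_sub s v).symm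

theorem card_arc (s : Fin n) {k : ℕ} (hk : k ≤ n) : (arc s k).card = k := by
  rw [← Finset.card_range k]
  refine Finset.card_nbij' (fun v => (v - s).val) (arcPoint s) ?_ ?_ ?_ ?_
  · intro v hv
    simpa [mem_arc] using hv
  · intro j hj
    have hj : j < k := by simpa using hj
    simpa [mem_arc, arcPoint_sub_val s (hj.trans_le hk)] using hj
  · intro v _
    exact arcPoint_val_sub s v
  · intro j hj
    have hj : j < k := by simpa using hj
    exact arcPoint_sub_val s (hj.trans_le hk)

omit [NeZero n] in
theorem arc_zero (s : Fin n) : arc s 0 = ∅ := by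
  simp [arc]

omit [NeZero n] in
theorem arc_self (s : Fin n) : arc s n = Finset.univ := by
  simp [arc]

theorem start_mem_arc (s : Fin n) {k : ℕ} (hk : 0 < k) : s ∈ arc s k := by
  simpa [mem_arc] using hk

theorem cycleGraph_adj_iff_sub (s u v : Fin n) :
    (SimpleGraph.cycleGraph n).Adj u v ↔
      ((u - s).val + 1 = (v - s).val ∨ (v - s).val + 1 = (u - s).val ∨
        ((u - s).val = 0 ∧ (v - s).val + 1 = n ∨ (v - s).val = 0 ∧ (u - s).val + 1 = n) ∧
          2 ≤ n) := by
  rw [SimpleGraph.cycleGraph_adj', Fin.val_sub_eq_ite_sub s u v, Fin.val_sub_eq_ite_sub s v u]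
  have hu := (u - s).2
  have hv := (v - s).2
  split_ifs <;> omega

theorem connected_arc (s : Fin n) {k : ℕ} (hk : 0 < k) (hkn : k ≤ n) :
    ((SimpleGraph.cycleGraph n).induce (arc s k : Set (Fin n))).Connected := by
  refine SimpleGraph.connected_induce_of_exists_adj ⟨s, start_mem_arc s hk⟩ fun A hA hne hAk => ?_
  by_contra! hcon
  have hmem : ∀ j < k, arcPoint s j ∈ arc s k := fun j hj => by
    rwa [mem_arc, arcPoint_sub_val s (by omega)]
  have hadj : ∀ j, j + 1 < k →
      (SimpleGraph.cycleGraph n).Adj (arcPoint s j) (arcPoint s (j + 1)) := fun j hj => by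
    rw [cycleGraph_adj_iff_sub s, arcPoint_sub_val s (by omega), arcPoint_sub_val s (by omega)]
    exact .inl rfl
  have key : ∀ j < k, (arcPoint s j ∈ A ↔ arcPoint s 0 ∈ A) := by
    intro j
    induction j with
    | zero => simp
    | succ j ih =>
      intro hj
      rw [← ih (by omega)]
      constructor
      · intro h
        by_contra h'
        exact hcon _ h _ (hmem j (by omega)) h' (hadj j hj).symm
      · intro h
        by_contra h'
        exact hcon _ h _ (hmem (j + 1) hj) h' (hadj j hj)
  obtain ⟨a, ha⟩ := hne
  have h0 : arcPoint s 0 ∈ A := by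
    rw [← key _ (mem_arc.1 (hA ha)), arcPoint_val_sub]
    exact ha
  refine hAk (hA.antisymm fun v hv => ?_)
  have := (key _ (mem_arc.1 hv)).2 h0
  rwa [arcPoint_val_sub] at this

/-- The tubes in a proper arc that contain its first vertex are its initial segments. -/
theorem mem_tubesAt_arc {s : Fin n} {l : ℕ} (hl : l < n) {t : Finset (Fin n)} :
    t ∈ tubesAt (SimpleGraph.cycleGraph n) (arc s l) s ↔ ∃ k, 0 < k ∧ k ≤ l ∧ t = arc s k := by
  classical
  rw [mem_tubesAt]
  constructor
  · rintro ⟨htl, hs, ht⟩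
    -- `k` is the length of the longest initial segment of the arc that lies in `t`.
    have hex : ∃ j, j < n ∧ arcPoint s j ∉ t := by
      refine ⟨l, hl, fun h => ?_⟩
      have := mem_arc.1 (htl h)
      rw [arcPoint_sub_val s hl] at this
      omega
    obtain ⟨hkn, hkt⟩ := Nat.find_spec hex
    have hmin : ∀ j < Nat.find hex, arcPoint s j ∈ t := fun j hj => by
      by_contra h
      exact Nat.find_min hex hj ⟨by omega, h⟩
    generalize Nat.find hex = k at hkn hkt hmin
    have hk0 : 0 < k := by
      rcases Nat.eq_zero_or_pos k with rfl | h
      · exact absurd (by simpa [arcPoint] using hs) hkt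
      · exact h
    have hkl : k ≤ l := by
      have h1 := mem_arc.1 (htl (hmin (k - 1) (by omega)))
      rw [arcPoint_sub_val s (by omega)] at h1
      omega
    have hsub : arc s k ⊆ t := fun v hv => by
      have := hmin _ (mem_arc.1 hv)
      rwa [arcPoint_val_sub] at this
    refine ⟨k, hk0, hkl, ?_⟩
    by_contra hne
    obtain ⟨a, ha, b, hb, hbA, hab⟩ := ht.exists_adj_of_ssubset hsub ⟨s, start_mem_arc s hk0⟩
      (Ne.symm hne)
    have hb' := mem_arc.1 (htl hb)
    rw [mem_arc] at ha hbA
    rw [cycleGraph_adj_iff_sub s] at hab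
    have hbk : (b - s).val = k := by omega
    exact hkt ((eq_arcPoint_iff hkn).2 hbk ▸ hb)
  · rintro ⟨k, hk, hkl, rfl⟩
    refine ⟨fun v hv => ?_, start_mem_arc s hk, connected_arc s hk (by omega)⟩
    rw [mem_arc] at hv ⊢
    omega

theorem separatedFrom_arc (s : Fin n) {k l : ℕ} (hk : 0 < k) (hkl : k ≤ l) (hl : l < n) :
    separatedFrom (SimpleGraph.cycleGraph n) (arc s l) (arc s k) =
      arc (arcPoint s (k + 1)) (l - k - 1) := by
  ext v
  rw [mem_separatedFrom, mem_arc, mem_arc, mem_arc]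
  have hv := (v - s).2
  rcases Nat.lt_or_ge l (k + 2) with hlk | hlk
  · rw [show l - k - 1 = 0 by omega]
    refine iff_of_false (fun h => ?_) (by omega)
    refine h.2.2 (arcPoint s (k - 1)) ?_ ?_
    · rw [mem_arc, arcPoint_sub_val s (by omega)]; omega
    · rw [cycleGraph_adj_iff_sub s, arcPoint_sub_val s (by omega)]; omega
  · rw [Fin.val_sub_eq_ite_sub s v (arcPoint s (k + 1)), arcPoint_sub_val s (by omega)]
    constructor
    · rintro ⟨h1, h2, h3⟩
      have h4 : (v - s).val ≠ k := fun h => by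
        refine h3 (arcPoint s (k - 1)) ?_ ?_
        · rw [mem_arc, arcPoint_sub_val s (by omega)]; omega
        · rw [cycleGraph_adj_iff_sub s, arcPoint_sub_val s (by omega)]; omega
      split_ifs <;> omega
    · intro h
      have h' : k + 1 ≤ (v - s).val ∧ (v - s).val < l := by
        split_ifs at h <;> omega
      refine ⟨h'.2, by omega, fun a ha => ?_⟩
      rw [mem_arc] at ha
      rw [cycleGraph_adj_iff_sub s]
      omega

theorem separatedFrom_univ_arc (s : Fin n) {k : ℕ} (hk : 0 < k) (hkn : k < n) :
    separatedFrom (SimpleGraph.cycleGraph n) Finset.univ (arc s k) =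
      arc (arcPoint s (k + 1)) (n - k - 2) := by
  ext v
  rw [mem_separatedFrom, mem_arc, mem_arc]
  have hv := (v - s).2
  have hend : (v - s).val = k → ∃ a ∈ arc s k, (SimpleGraph.cycleGraph n).Adj a v := fun h => by
    refine ⟨arcPoint s (k - 1), ?_, ?_⟩
    · rw [mem_arc, arcPoint_sub_val s (by omega)]; omega
    · rw [cycleGraph_adj_iff_sub s, arcPoint_sub_val s (by omega)]; omega
  have hstart : (v - s).val + 1 = n → ∃ a ∈ arc s k, (SimpleGraph.cycleGraph n).Adj a v :=
    fun h => by
    refine ⟨s, start_mem_arc s hk, ?_⟩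
    rw [cycleGraph_adj_iff_sub s, sub_self]
    have h0 : (0 : Fin n).val = 0 := Fin.val_eq_zero_iff.2 rfl
    omega
  rcases Nat.lt_or_ge n (k + 3) with hlk | hlk
  · rw [show n - k - 2 = 0 by omega]
    refine iff_of_false (fun h => ?_) (by omega)
    have h2 := h.2.1
    have : (v - s).val = k ∨ (v - s).val + 1 = n := by omega
    obtain ⟨a, ha, hav⟩ := this.elim hend hstart
    exact h.2.2 a ha hav
  · rw [Fin.val_sub_eq_ite_sub s v (arcPoint s (k + 1)), arcPoint_sub_val s (by omega)]
    constructor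
    · rintro ⟨-, h2, h3⟩
      have h4 : (v - s).val ≠ k := fun h => by
        obtain ⟨a, ha, hav⟩ := hend h
        exact h3 a ha hav
      have h5 : (v - s).val + 1 ≠ n := fun h => by
        obtain ⟨a, ha, hav⟩ := hstart h
        exact h3 a ha hav
      split_ifs <;> omega
    · intro h
      have h' : k + 1 ≤ (v - s).val ∧ (v - s).val + 1 < n := by
        split_ifs at h <;> omega
      refine ⟨Finset.mem_univ _, by omega, fun a ha => ?_⟩
      rw [mem_arc] at ha
      rw [cycleGraph_adj_iff_sub s]
      omega

theorem arc_erase_start (s : Fin n) {l : ℕ} (hl : l < n) :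
    (arc s (l + 1)).erase s = arc (arcPoint s 1) l := by
  ext v
  have hv := (v - s).2
  have hvs : v ≠ s ↔ (v - s).val ≠ 0 := by
    rw [← sub_ne_zero, Ne, Ne, ← Fin.val_eq_zero_iff]
  rw [Finset.mem_erase, mem_arc, mem_arc, hvs]
  rcases Nat.lt_or_ge 1 n with h1 | h1
  · rw [Fin.val_sub_eq_ite_sub s v (arcPoint s 1), arcPoint_sub_val s h1]
    split_ifs <;> omega
  · omega

theorem arc_injective {s s' : Fin n} {k k' : ℕ} (hk : 0 < k) (hkn : k < n) (hk' : k' < n)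
    (h : arc s k = arc s' k') : s = s' ∧ k = k' := by
  have hkk : k = k' := by
    rw [← card_arc s hkn.le, h, card_arc s' hk'.le]
  subst hkk
  refine ⟨?_, rfl⟩
  -- The vertex before `s` is not in the arc that starts at `s`.
  have h1 : s ∈ arc s' k := h ▸ start_mem_arc s hk
  have h2 : arcPoint s (n - 1) ∉ arc s' k := by
    rw [← h, mem_arc, arcPoint_sub_val s (by omega)]
    omega
  rw [mem_arc] at h1 h2
  have h3 := Fin.val_sub_eq_ite_sub s' (arcPoint s (n - 1)) s
  rw [arcPoint_sub_val s (by omega)] at h3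
  have h4 := (arcPoint s (n - 1) - s').2
  have h5 : (s - s').val = 0 := by
    split_ifs at h3 <;> omega
  exact sub_eq_zero.1 (Fin.val_eq_zero_iff.1 h5)

/-- The connected sets of vertices of a cycle, except for the set of all vertices, are arcs. -/
theorem exists_eq_arc_of_connected {t : Finset (Fin n)}
    (ht : ((SimpleGraph.cycleGraph n).induce (t : Set (Fin n))).Connected)
    (hne : t ≠ Finset.univ) : ∃ s k, 0 < k ∧ k < n ∧ t = arc s k := by
  classical
  obtain ⟨w, hw⟩ : ∃ w, w ∉ t := by
    by_contra! h
    exact hne (Finset.eq_univ_iff_forall.2 h)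
  obtain ⟨v, hv⟩ := ht.finset_nonempty
  have hex : ∃ j, arcPoint w j ∈ t := ⟨_, (arcPoint_val_sub w v).symm ▸ hv⟩
  have hj := Nat.find_spec hex
  have hjn : Nat.find hex < n :=
    (Nat.find_min' hex ((arcPoint_val_sub w v).symm ▸ hv)).trans_lt (v - w).2
  have hmin : ∀ i < Nat.find hex, arcPoint w i ∉ t := fun i hi => Nat.find_min hex hi
  generalize Nat.find hex = j at hj hjn hmin
  have hj0 : 0 < j := by
    rcases Nat.eq_zero_or_pos j with rfl | h
    · exact absurd (by simpa [arcPoint] using hj) hw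
    · exact h
  set s := arcPoint w j with hs
  have hsub : t ⊆ arc s (n - 1) := by
    intro u hu
    rw [mem_arc, Fin.val_sub_eq_ite_sub w u s, hs, arcPoint_sub_val w hjn]
    have hu' := (u - w).2
    have h1 : ¬ (u - w).val < j := fun h => hmin _ h ((arcPoint_val_sub w u).symm ▸ hu)
    split_ifs <;> omega
  have hn : 0 < n := NeZero.pos n
  obtain ⟨k, hk, hkn, rfl⟩ := (mem_tubesAt_arc (by omega)).1 (mem_tubesAt.2 ⟨hsub, hj, ht⟩)
  exact ⟨s, k, hk, by omega, rfl⟩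

/-- The tubes of a cycle through a vertex `v`: the set of all vertices and, for each `k < n`, the
`k` arcs of length `k` through `v`. -/
theorem sum_tubesAt_univ {M : Type*} [AddCommMonoid M] (v : Fin n) (f : Finset (Fin n) → M) :
    ∑ t ∈ tubesAt (SimpleGraph.cycleGraph n) Finset.univ v, f t = f Finset.univ +
      ∑ k ∈ Finset.range (n - 1), ∑ i ∈ Finset.range (k + 1),
        f (arc (v - Fin.ofNat n i) (k + 1)) := by
  classical
  have hn : 0 < n := NeZero.pos n
  have huniv : Finset.univ ∈ tubesAt (SimpleGraph.cycleGraph n) Finset.univ v := by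
    rw [mem_tubesAt]
    exact ⟨subset_rfl, Finset.mem_univ _, arc_self v ▸ connected_arc v hn le_rfl⟩
  rw [← Finset.add_sum_erase _ _ huniv, Finset.sum_sigma']
  congr 1
  symm
  refine Finset.sum_bij (fun p _ => arc (v - Fin.ofNat n p.2) (p.1 + 1)) ?_ ?_ ?_ ?_
  · rintro ⟨k, i⟩ hp
    simp only [Finset.mem_sigma, Finset.mem_range] at hp
    dsimp only
    refine Finset.mem_erase.2 ⟨fun h => ?_, mem_tubesAt.2 ⟨Finset.subset_univ _, ?_,
      connected_arc _ (by omega) (by omega)⟩⟩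
    · have := congrArg Finset.card h
      rw [card_arc _ (by omega), Finset.card_univ, Fintype.card_fin] at this
      omega
    · rw [mem_arc, sub_sub_cancel, Fin.val_ofNat, Nat.mod_eq_of_lt (by omega)]
      exact hp.2
  · rintro ⟨k, i⟩ hp ⟨k', i'⟩ hp' h
    simp only [Finset.mem_sigma, Finset.mem_range] at hp hp'
    dsimp only at h
    obtain ⟨h1, h2⟩ := arc_injective (by omega) (by omega) (by omega) h
    have h3 := congrArg Fin.val (sub_right_injective h1)
    simp only [Fin.val_ofNat] at h3
    rw [Nat.mod_eq_of_lt (by omega), Nat.mod_eq_of_lt (by omega)] at h3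
    obtain rfl : k = k' := by omega
    subst h3
    rfl
  · intro t ht
    obtain ⟨hne, ht⟩ := Finset.mem_erase.1 ht
    obtain ⟨-, hvt, ht⟩ := mem_tubesAt.1 ht
    obtain ⟨s, k, hk, hkn, rfl⟩ := exists_eq_arc_of_connected ht hne
    rw [mem_arc] at hvt
    refine ⟨⟨k - 1, (v - s).val⟩, ?_, ?_⟩
    · simp only [Finset.mem_sigma, Finset.mem_range]
      omega
    · have : v - Fin.ofNat n (v - s).val = s := by simp
      simp only [this, Nat.sub_add_cancel hk]
  · intro _ _
    rfl

end Arcs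

/-! ### Recursions for tubings of paths and cycles -/

section Recursions

variable {R : Type*} [CommRing R]

theorem tubingSum_arc_succ {n : ℕ} [NeZero n] (x c : R) (s : Fin n) {l : ℕ} (hl : l + 1 < n) :
    tubingSum (SimpleGraph.cycleGraph n) x c (arc s (l + 1)) =
      c * tubingSum (SimpleGraph.cycleGraph n) x c (arc (arcPoint s 1) l) +
      ∑ k ∈ Finset.range (l + 1), topTubingSum (SimpleGraph.cycleGraph n) x (arc s (k + 1)) *
        (c ^ (l - k - (l - k - 1)) * tubingSum (SimpleGraph.cycleGraph n) x c
          (arc (arcPoint s (k + 2)) (l - k - 1))) := by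
  rw [tubingSum_eq_add_sum (start_mem_arc s (Nat.succ_pos l)), arc_erase_start s (by omega)]
  congr 1
  symm
  refine Finset.sum_bij (fun k _ => arc s (k + 1)) ?_ ?_ ?_ ?_
  · intro k hk
    rw [Finset.mem_range] at hk
    exact (mem_tubesAt_arc hl).2 ⟨k + 1, by omega, by omega, rfl⟩
  · intro k hk k' hk' h
    rw [Finset.mem_range] at hk hk'
    have := (arc_injective (by omega) (by omega) (by omega) h).2
    omega
  · intro t ht
    obtain ⟨k, hk, hkl, rfl⟩ := (mem_tubesAt_arc hl).1 ht
    exact ⟨k - 1, Finset.mem_range.2 (by omega), by rw [Nat.sub_add_cancel hk]⟩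
  · intro k hk
    rw [Finset.mem_range] at hk
    rw [separatedFrom_arc s (by omega) (by omega) hl, card_arc _ (by omega), card_arc _ (by omega),
      card_arc _ (by omega)]
    rw [show l + 1 - (k + 1) = l - k by omega]

/-- The weighted number of tubings of a path with `l` vertices, as an arc of a cycle with one more
vertex. -/
noncomputable def pathSum (x c : R) (l : ℕ) : R :=
  tubingSum (SimpleGraph.cycleGraph (l + 1)) x c (arc 0 l)

/-- The weighted number of tubings of a path with `l` vertices to which the whole path belongs. -/
noncomputable def pathTopSum (x : R) (l : ℕ) : R :=
  topTubingSum (SimpleGraph.cycleGraph (l + 1)) x (arc 0 l)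

theorem pathSum_zero (x c : R) : pathSum x c 0 = 1 := by
  rw [pathSum, arc_zero, tubingSum_empty]

theorem pathSum_succ_self (x : R) (l : ℕ) :
    pathSum x x (l + 1) = (1 + x) * pathTopSum x (l + 1) :=
  tubingSum_self_eq (connected_arc _ (by omega) (by omega)) x

/-- The enumeration of the tubings of a proper arc depends only on the length of the arc: the
recursions at the first vertex have the same form. The recursion with `c = x` and
`tubingSum_self_eq` determine the tubings to which the arc belongs, up to a factor `x`. -/
theorem arc_sums_congr [IsDomain R] {x : R} (hx : x ≠ 0) (l : ℕ) :
    ∀ {n n' : ℕ} [NeZero n] [NeZero n'] (s : Fin n) (s' : Fin n'), l < n → l < n' →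
      (∀ c : R, tubingSum (SimpleGraph.cycleGraph n) x c (arc s l) =
        tubingSum (SimpleGraph.cycleGraph n') x c (arc s' l)) ∧
      (0 < l → topTubingSum (SimpleGraph.cycleGraph n) x (arc s l) =
        topTubingSum (SimpleGraph.cycleGraph n') x (arc s' l)) := by
  induction l using Nat.strong_induction_on with
  | _ l ih =>
    intro n n' _ _ s s' hn hn'
    rcases l with _ | l
    · simp [arc_zero, tubingSum_empty]
    -- Only the term with `k = l` of the recursion is not covered by the induction hypothesis.
    have hsum : ∀ c : R, ∑ k ∈ Finset.range l,
        topTubingSum (SimpleGraph.cycleGraph n) x (arc s (k + 1)) *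
        (c ^ (l - k - (l - k - 1)) * tubingSum (SimpleGraph.cycleGraph n) x c
          (arc (arcPoint s (k + 2)) (l - k - 1))) = ∑ k ∈ Finset.range l,
        topTubingSum (SimpleGraph.cycleGraph n') x (arc s' (k + 1)) *
        (c ^ (l - k - (l - k - 1)) * tubingSum (SimpleGraph.cycleGraph n') x c
          (arc (arcPoint s' (k + 2)) (l - k - 1))) := by
      intro c
      refine Finset.sum_congr rfl fun k hk => ?_
      rw [Finset.mem_range] at hk
      rw [(ih (k + 1) (by omega) s s' (by omega) (by omega)).2 (by omega),
        (ih (l - k - 1) (by omega) (arcPoint s (k + 2)) (arcPoint s' (k + 2)) (by omega)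
          (by omega)).1 c]
    have hrec : ∀ c : R, tubingSum (SimpleGraph.cycleGraph n) x c (arc s (l + 1)) -
        topTubingSum (SimpleGraph.cycleGraph n) x (arc s (l + 1)) =
        tubingSum (SimpleGraph.cycleGraph n') x c (arc s' (l + 1)) -
        topTubingSum (SimpleGraph.cycleGraph n') x (arc s' (l + 1)) := by
      intro c
      rw [tubingSum_arc_succ x c s hn, tubingSum_arc_succ x c s' hn',
        Finset.sum_range_succ, Finset.sum_range_succ, hsum c,
        (ih l (by omega) (arcPoint s 1) (arcPoint s' 1) (by omega) (by omega)).1 c]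
      simp only [Nat.sub_self, Nat.zero_sub, arc_zero, tubingSum_empty]
      ring
    have htop : topTubingSum (SimpleGraph.cycleGraph n) x (arc s (l + 1)) =
        topTubingSum (SimpleGraph.cycleGraph n') x (arc s' (l + 1)) := by
      have h := hrec x
      rw [tubingSum_self_eq (connected_arc s (by omega) hn.le) x,
        tubingSum_self_eq (connected_arc s' (by omega) hn'.le) x] at h
      exact mul_left_cancel₀ hx (by linear_combination h)
    exact ⟨fun c => by linear_combination hrec c + htop, fun _ => htop⟩

variable [IsDomain R] {x : R} (hx : x ≠ 0)

include hx

theorem tubingSum_arc {n : ℕ} [NeZero n] (c : R) (s : Fin n) {l : ℕ} (hl : l < n) :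
    tubingSum (SimpleGraph.cycleGraph n) x c (arc s l) = pathSum x c l :=
  (arc_sums_congr hx l s 0 hl (Nat.lt_succ_self l)).1 c

theorem topTubingSum_arc {n : ℕ} [NeZero n] (s : Fin n) {l : ℕ} (hl : l + 1 < n) :
    topTubingSum (SimpleGraph.cycleGraph n) x (arc s (l + 1)) = pathTopSum x (l + 1) :=
  (arc_sums_congr hx (l + 1) s 0 hl (Nat.lt_succ_self _)).2 (Nat.succ_pos l)

theorem pathSum_succ (c : R) (l : ℕ) :
    pathSum x c (l + 1) = c * pathSum x c l + ∑ k ∈ Finset.range (l + 1), pathTopSum x (k + 1) *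
      (c ^ (l - k - (l - k - 1)) * pathSum x c (l - k - 1)) := by
  rw [pathSum, tubingSum_arc_succ x c 0 (Nat.lt_succ_self _), tubingSum_arc hx c _ (by omega)]
  congr 1
  refine Finset.sum_congr rfl fun k hk => ?_
  rw [Finset.mem_range] at hk
  rw [tubingSum_arc hx c _ (by omega), topTubingSum_arc hx _ (by omega)]

/-- The recursion for the cycle. An arc of length `k + 1` leaves `m - k` vertices, of which both
ends are adjacent to the arc; the two ends coincide for `k + 1 = m`. -/
theorem tubingSum_cycleGraph_succ (c : R) (m : ℕ) :
    tubingSum (SimpleGraph.cycleGraph (m + 1)) x c Finset.univ = c * pathSum x c m +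
      (topTubingSum (SimpleGraph.cycleGraph (m + 1)) x Finset.univ +
      ∑ k ∈ Finset.range m, ((k + 1 : ℕ) : R) * (pathTopSum x (k + 1) *
        (c ^ (m - k - (m - k - 2)) * pathSum x c (m - k - 2)))) := by
  have hsep : separatedFrom (SimpleGraph.cycleGraph (m + 1)) Finset.univ Finset.univ = ∅ := by
    ext; simp [mem_separatedFrom]
  rw [tubingSum_eq_add_sum (Finset.mem_univ 0), sum_tubesAt_univ, hsep, tubingSum_empty]
  congr 1
  · rw [← arc_self 0, arc_erase_start 0 (Nat.lt_succ_self m),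
      tubingSum_arc hx c _ (Nat.lt_succ_self m)]
  congr 1
  · simp
  simp only [Nat.add_sub_cancel]
  refine Finset.sum_congr rfl fun k hk => ?_
  rw [Finset.mem_range] at hk
  rw [← nsmul_eq_mul, ← Finset.card_range (k + 1), ← Finset.sum_const, Finset.card_range]
  refine Finset.sum_congr rfl fun i _ => ?_
  rw [separatedFrom_univ_arc _ (by omega) (by omega), card_arc _ (by omega), card_arc _ (by omega),
    tubingSum_arc hx c _ (by omega), topTubingSum_arc hx _ (by omega), Finset.card_univ,
    Fintype.card_fin, Nat.add_sub_add_right]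

end Recursions

/-! ### Generating functions of tubings of paths and cycles -/

section Series

open PowerSeries

variable {R : Type*} [CommRing R]

theorem topTubingSum_empty {V : Type*} [DecidableEq V] (G : SimpleGraph V) (x : R) :
    topTubingSum G x ∅ = 0 := by
  refine Finset.sum_eq_zero fun T hT => ?_
  obtain ⟨hT, hmem⟩ := Finset.mem_filter.1 hT
  exact absurd ((mem_tubingsIn.1 hT).1.connected _ hmem).finset_nonempty Finset.not_nonempty_empty

/-- The generating function, by the number of vertices, of the tubings of paths. -/
noncomputable def pathSeries (x c : R) : R⟦X⟧ := .mk (pathSum x c)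

/-- The generating function, by the number of vertices, of the tubings of paths to which the whole
path belongs, with constant term `1`. -/
noncomputable def pathTopSeries (x : R) : R⟦X⟧ := 1 + .mk (pathTopSum x)

/-- The generating function of the tubings of cycles. -/
noncomputable def cycleSeries (x c : R) : R⟦X⟧ :=
  .mk fun n => tubingSum (SimpleGraph.cycleGraph n) x c Finset.univ

/-- The generating function of the tubings of cycles to which the whole cycle belongs. -/
noncomputable def cycleTopSeries (x : R) : R⟦X⟧ :=
  .mk fun n => topTubingSum (SimpleGraph.cycleGraph n) x Finset.univ

/-- The square root in the generating function of the halohedra, expressed by the tubings of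
paths. -/
noncomputable def rootSeries (x : R) : R⟦X⟧ :=
  1 + C x * X - 2 * C (1 + x) * X * pathTopSeries x

theorem pathTopSum_zero (x : R) : pathTopSum x 0 = 0 := by
  rw [pathTopSum, arc_zero, topTubingSum_empty]

theorem coeff_one_add_mul_pathSeries (x c : R) (j : ℕ) :
    coeff j (1 + C c * X * pathSeries x c) = c ^ (j - (j - 1)) * pathSum x c (j - 1) := by
  rcases j with _ | j
  · simp [pathSum_zero]
  · rw [map_add, coeff_one, if_neg (Nat.succ_ne_zero j), mul_assoc, coeff_C_mul, coeff_succ_X_mul,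
      pathSeries, coeff_mk, Nat.add_sub_cancel, Nat.add_sub_cancel_left, pow_one, zero_add]

theorem coeff_succ_mul (f g : R⟦X⟧) (m : ℕ) : coeff (m + 1) (f * g) =
    coeff 0 f * coeff (m + 1) g +
      ∑ k ∈ Finset.range (m + 1), coeff (k + 1) f * coeff (m - k) g := by
  rw [coeff_mul, Finset.Nat.sum_antidiagonal_succ, Finset.Nat.sum_antidiagonal_eq_sum_range_succ
    fun i j => coeff (i + 1) f * coeff j g]

theorem coeff_succ_pathTopSeries (x : R) (k : ℕ) :
    coeff (k + 1) (pathTopSeries x) = pathTopSum x (k + 1) := by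
  simp [pathTopSeries, coeff_one]

theorem coeff_succ_X_mul_derivative_pathTopSeries (x : R) (k : ℕ) :
    coeff (k + 1) (X * derivative R (pathTopSeries x)) =
      ((k + 1 : ℕ) : R) * pathTopSum x (k + 1) := by
  rw [coeff_succ_X_mul, coeff_derivative, coeff_succ_pathTopSeries, mul_comm]
  push_cast
  rfl

theorem constantCoeff_rootSeries (x : R) : constantCoeff (rootSeries x) = 1 := by
  simp [rootSeries]

variable [IsDomain R] {x : R} (hx : x ≠ 0)

include hx

theorem pathSeries_eq (c : R) :
    pathSeries x c = pathTopSeries x * (1 + C c * X * pathSeries x c) := by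
  ext m
  rcases m with _ | m
  · simp [pathSeries, pathTopSeries, pathSum_zero, pathTopSum_zero]
  · rw [coeff_succ_mul, coeff_one_add_mul_pathSeries, pathSeries, coeff_mk, pathSum_succ hx]
    congr 1
    · simp [pathTopSeries, pathTopSum_zero]
    · refine Finset.sum_congr rfl fun k _ => ?_
      rw [coeff_succ_pathTopSeries, ← pathSeries, coeff_one_add_mul_pathSeries]

omit [IsDomain R] hx in
theorem pathSeries_self_eq (x : R) :
    pathSeries x x = 1 + C (1 + x) * (pathTopSeries x - 1) := by
  ext m
  rcases m with _ | m
  · simp [pathSeries, pathTopSeries, pathSum_zero, pathTopSum_zero]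
  · simp only [pathSeries, coeff_mk, pathTopSeries, add_sub_cancel_left, map_add (coeff (m + 1)),
      coeff_one, coeff_C_mul, pathSum_succ_self]
    simp

theorem pathTopSeries_quadratic :
    C (1 + x) * X * pathTopSeries x ^ 2 + 1 = (1 + C x * X) * pathTopSeries x := by
  have h1 := pathSeries_eq hx x
  have h2 := pathSeries_self_eq x
  rw [h2] at h1
  have hC : (C (1 + x) : R⟦X⟧) = 1 + C x := by simp
  rw [hC] at h1 ⊢
  refine mul_left_cancel₀ ((map_ne_zero_iff _ C_injective).2 hx) ?_
  linear_combination -h1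

theorem rootSeries_sq :
    rootSeries x ^ 2 = 1 - 2 * (2 + C x) * X + C x ^ 2 * X ^ 2 := by
  have h := pathTopSeries_quadratic hx
  have hC : (C (1 + x) : R⟦X⟧) = 1 + C x := by simp
  rw [rootSeries]
  rw [hC] at h ⊢
  linear_combination 4 * (1 + C x) * X * h

theorem rootSeries_mul_derivative : rootSeries x * derivative R (pathTopSeries x) =
    C (1 + x) * pathTopSeries x ^ 2 - C x * pathTopSeries x := by
  have h := congrArg (derivative R) (pathTopSeries_quadratic hx)
  simp only [map_add, Derivation.leibniz, Derivation.leibniz_pow, derivative_C, derivative_X,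
    smul_eq_mul, nsmul_eq_mul, Derivation.map_one_eq_zero] at h
  rw [rootSeries]
  simp only [map_add, map_one] at h ⊢
  push_cast at h
  linear_combination -h

theorem cycleSeries_eq (c : R) : cycleSeries x c = 1 + C c * X * pathSeries x c + cycleTopSeries x +
    X * derivative R (pathTopSeries x) * (C c * X * (1 + C c * X * pathSeries x c)) := by
  ext m
  rcases m with _ | m
  · simp [cycleSeries, cycleTopSeries, tubingSum_empty, topTubingSum_empty]
  · rw [map_add, map_add, coeff_one_add_mul_pathSeries, coeff_succ_mul, cycleSeries, coeff_mk,
      cycleTopSeries, coeff_mk, tubingSum_cycleGraph_succ hx, Finset.sum_range_succ]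
    have h1 : ∀ k ∈ Finset.range m, coeff (k + 1) (X * derivative R (pathTopSeries x)) *
        coeff (m - k) (C c * X * (1 + C c * X * pathSeries x c)) = ((k + 1 : ℕ) : R) *
        (pathTopSum x (k + 1) * (c ^ (m - k - (m - k - 2)) * pathSum x c (m - k - 2))) := by
      intro k hk
      rw [Finset.mem_range] at hk
      obtain ⟨j, hj⟩ : ∃ j, m - k = j + 1 := ⟨m - k - 1, by omega⟩
      rw [coeff_succ_X_mul_derivative_pathTopSeries, hj, mul_assoc (C c) X, coeff_C_mul,
        coeff_succ_X_mul, coeff_one_add_mul_pathSeries, mul_assoc, ← mul_assoc c, ← pow_succ']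
      rw [show j + 1 - 2 = j - 1 by omega, show j + 1 - (j - 1) = j - (j - 1) + 1 by omega]
    rw [Finset.sum_congr rfl h1]
    simp
    ring

omit [IsDomain R] hx in
theorem cycleSeries_self_eq (x : R) : cycleSeries x x = 1 + C (1 + x) * cycleTopSeries x := by
  ext m
  rcases m with _ | m
  · simp [cycleSeries, cycleTopSeries, tubingSum_empty, topTubingSum_empty]
  · rw [map_add, coeff_C_mul, coeff_one, if_neg (Nat.succ_ne_zero m), zero_add, cycleSeries,
      coeff_mk, cycleTopSeries, coeff_mk, ← arc_self 0,
      tubingSum_self_eq (connected_arc 0 (by omega) le_rfl)]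

/-- The generating function of the halohedra, with the denominator cleared. -/
theorem two_mul_cycleSeries_mul_rootSeries :
    2 * cycleSeries x (1 + x) * rootSeries x = 1 + (2 + C x) * X + rootSeries x := by
  set b := pathTopSeries x with hb
  set d := derivative R b with hd
  have hroot : rootSeries x = 1 + C x * X - 2 * C (1 + x) * X * b := rfl
  have hK : C (1 + x) * X * b ^ 2 + 1 = (1 + C x * X) * b := pathTopSeries_quadratic hx
  have hSd : rootSeries x * d = C (1 + x) * b ^ 2 - C x * b := rootSeries_mul_derivative hx
  set r : R → R⟦X⟧ := fun c => 1 + C c * X * pathSeries x c with hr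
  have hQ : ∀ c, pathSeries x c = b * r c := pathSeries_eq hx
  have hrc : ∀ c, r c * (1 - C c * X * b) = 1 := fun c => by
    have : r c = 1 + C c * X * (b * r c) := by rw [← hQ c]
    linear_combination this
  have hcyc : ∀ c, cycleSeries x c = r c + cycleTopSeries x + X * d * (C c * X * r c) :=
    cycleSeries_eq hx
  have htop : cycleTopSeries x = X * (b * r x) + X * d * (X * r x) := by
    have h1 := hcyc x
    rw [cycleSeries_self_eq] at h1
    have h2 : r x = 1 + C x * X * (b * r x) := by rw [← hQ x]
    have hC : (C (1 + x) : R⟦X⟧) = 1 + C x := by simp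
    rw [hC] at h1
    refine mul_left_cancel₀ ((map_ne_zero_iff _ C_injective).2 hx) ?_
    linear_combination h1 + h2
  have h3 : r (1 + x) = 1 + C (1 + x) * X * (b * r (1 + x)) := by rw [← hQ]
  have h4 := hrc (1 + x)
  have h5 := hrc x
  -- Both denominators of `cycleSeries` divide `rootSeries x * (b + X * d)`.
  have h6 : rootSeries x * (b + X * d) = b * (1 - C (1 + x) * X * b) := by
    linear_combination X * hSd + b * hroot
  have h7 : b * (1 - C (1 + x) * X * b) = 1 - C x * X * b := by linear_combination -hK
  have h8 : cycleSeries x (1 + x) * rootSeries x = rootSeries x + X * (C (1 + x) * b + 1) := by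
    rw [hcyc, htop]
    linear_combination rootSeries x * h3 + X * (C (1 + x) * r (1 + x) + r x) * h6 +
      X * C (1 + x) * b * h4 + X * r x * h7 + X * h5
  linear_combination 2 * h8 + hroot

end Series

/-! ### Tubings of hypercube graphs with edges at the positive vertices only -/

section Hypercube

variable {n : ℕ} {G : SimpleGraph (Fin n)}

/-- The tube of positive vertices given by a set of vertices of `G`. -/
def positiveTube (t : Finset (Fin n)) : Finset (SignedVertex n) :=
  t.map Function.Embedding.inl

theorem inl_mem_positiveTube {t : Finset (Fin n)} {i : Fin n} :
    (Sum.inl i : SignedVertex n) ∈ positiveTube t ↔ i ∈ t := by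
  simp [positiveTube]

theorem inr_notMem_positiveTube {t : Finset (Fin n)} {i : Fin n} :
    (Sum.inr i : SignedVertex n) ∉ positiveTube t := by
  simp [positiveTube]

theorem positiveTube_injective : Function.Injective (positiveTube (n := n)) :=
  Finset.map_injective _

theorem positiveTube_ne_singleton_inr (t : Finset (Fin n)) (i : Fin n) :
    positiveTube t ≠ {Sum.inr i} := fun h =>
  inr_notMem_positiveTube (t := t) (i := i) (h ▸ Finset.mem_singleton_self _)

theorem positiveTube_ssubset {t u : Finset (Fin n)} :
    positiveTube t ⊂ positiveTube u ↔ t ⊂ u :=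
  Finset.map_ssubset_map

theorem positiveHypercubeGraph_not_adj_inr (v : SignedVertex n) (i : Fin n) :
    ¬ (positiveHypercubeGraph G).Adj v (Sum.inr i) := by
  rcases v with v | v <;> simp [positiveHypercubeGraph, SimpleGraph.sum]

theorem isTube_positiveHypercubeGraph_iff (t : Finset (SignedVertex n)) :
    IsTube (positiveHypercubeGraph G) t ↔
      (∃ u : Finset (Fin n), (G.induce (u : Set (Fin n))).Connected ∧ t = positiveTube u) ∨
        ∃ i, t = {Sum.inr i} := by
  constructor
  · rintro ⟨-, ht⟩
    by_cases h : ∃ i, Sum.inr i ∈ t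
    · obtain ⟨i, hi⟩ := h
      refine .inr ⟨i, ?_⟩
      by_contra hne
      obtain ⟨a, ha, b, -, -, hab⟩ := ht.exists_adj_of_ssubset (Finset.singleton_subset_iff.2 hi)
        (Finset.singleton_nonempty _) (Ne.symm hne)
      rw [Finset.mem_singleton] at ha
      subst ha
      exact positiveHypercubeGraph_not_adj_inr b i hab.symm
    · have htu : t = positiveTube t.toLeft := by
        ext (j | j)
        · simp [inl_mem_positiveTube]
        · exact iff_of_false (fun hj => h ⟨j, hj⟩) inr_notMem_positiveTube
      refine .inl ⟨t.toLeft, ?_, htu⟩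
      refine SimpleGraph.connected_induce_of_exists_adj ?_ fun A hA hne hAt => ?_
      · have := ht.finset_nonempty
        rw [htu, positiveTube, Finset.map_nonempty] at this
        exact this
      · rw [htu] at ht
        obtain ⟨a, ha, b, hb, hbA, hab⟩ := ht.exists_adj_of_ssubset (A := positiveTube A)
          (Finset.map_subset_map.2 hA) (Finset.map_nonempty.2 hne)
          fun h => hAt (positiveTube_injective h)
        rcases a with a | a <;> rcases b with b | b
        · rw [inl_mem_positiveTube] at ha hb hbA
          exact ⟨a, ha, b, hb, hbA, SimpleGraph.sum_adj_inl.1 hab⟩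
        · exact absurd hb inr_notMem_positiveTube
        · exact absurd ha inr_notMem_positiveTube
        · exact absurd ha inr_notMem_positiveTube
  · rintro (⟨u, hu, rfl⟩ | ⟨i, rfl⟩)
    · refine ⟨fun i hi => inr_notMem_positiveTube hi.2, ?_⟩
      refine SimpleGraph.connected_induce_of_exists_adj (Finset.map_nonempty.2 hu.finset_nonempty)
        fun A hA hne hAu => ?_
      have hAl : A = positiveTube A.toLeft := by
        ext (j | j)
        · simp [inl_mem_positiveTube]
        · exact iff_of_false (fun hj => inr_notMem_positiveTube (hA hj)) inr_notMem_positiveTube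
      rw [hAl] at hA hne hAu ⊢
      obtain ⟨a, ha, b, hb, hbA, hab⟩ := hu.exists_adj_of_ssubset (Finset.map_subset_map.1 hA)
        (Finset.map_nonempty.1 hne) fun h => hAu (h ▸ rfl)
      exact ⟨_, inl_mem_positiveTube.2 ha, _, inl_mem_positiveTube.2 hb,
        fun h => hbA (inl_mem_positiveTube.1 h), SimpleGraph.sum_adj_inl.2 hab⟩
    · refine ⟨fun j hj => by simp at hj, ?_⟩
      refine SimpleGraph.connected_induce_of_exists_adj (Finset.singleton_nonempty _)
        fun A hA hne hAi => ?_
      exact absurd ((Finset.subset_singleton_iff.1 hA).resolve_left hne.ne_empty) hAi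

theorem weaklyCompatible_positiveTube_iff {t u : Finset (Fin n)} :
    WeaklyCompatible (positiveHypercubeGraph G) (positiveTube t) (positiveTube u) ↔
      TubesCompatible G t u := by
  rw [WeaklyCompatible, TubesCompatible, positiveTube_ssubset, positiveTube_ssubset]
  refine or_congr_right (or_congr_right (and_congr (Finset.disjoint_map _) ?_))
  simp [positiveTube, positiveHypercubeGraph]

open scoped Classical in
/-- The set of tubes with the positive tubes `A` and the negative vertices `S`. -/
noncomputable def signedTubes (G : SimpleGraph (Fin n))
    (p : (_ : Finset (Finset (Fin n))) × Finset (Fin n)) :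
    Finset {t : Finset (SignedVertex n) // IsTube (positiveHypercubeGraph G) t} :=
  {t | (∃ a ∈ p.1, t.1 = positiveTube a) ∨ ∃ i ∈ p.2, t.1 = {Sum.inr i}}

theorem mem_signedTubes {p : (_ : Finset (Finset (Fin n))) × Finset (Fin n)}
    {t : {t : Finset (SignedVertex n) // IsTube (positiveHypercubeGraph G) t}} :
    t ∈ signedTubes G p ↔ (∃ a ∈ p.1, t.1 = positiveTube a) ∨ ∃ i ∈ p.2, t.1 = {Sum.inr i} := by
  simp [signedTubes]

/-- The pairs of a tubing of `G` and a set of vertices that it does not cover. -/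
noncomputable def signedTubings (G : SimpleGraph (Fin n)) :
    Finset ((_ : Finset (Finset (Fin n))) × Finset (Fin n)) :=
  (tubingsIn G Finset.univ).sigma fun A => (Finset.univ \ covered A).powerset

theorem mem_signedTubings {p : (_ : Finset (Finset (Fin n))) × Finset (Fin n)} :
    p ∈ signedTubings G ↔ IsGraphTubing G p.1 ∧ ∀ i ∈ p.2, i ∉ covered p.1 := by
  simp [signedTubings, mem_tubingsIn, Finset.subset_iff]

theorem map_signedTubes {p : (_ : Finset (Finset (Fin n))) × Finset (Fin n)}
    (hp : p ∈ signedTubings G) : (signedTubes G p).map (Function.Embedding.subtype _) =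
      (p.1.image positiveTube) ∪ p.2.image fun i => {Sum.inr i} := by
  obtain ⟨hA, -⟩ := mem_signedTubings.1 hp
  ext t
  simp only [Finset.mem_map, mem_signedTubes, Finset.mem_union, Finset.mem_image,
    Function.Embedding.subtype_apply, Subtype.exists, exists_and_right, exists_eq_right]
  constructor
  · rintro ⟨-, ⟨a, ha, rfl⟩ | ⟨i, hi, rfl⟩⟩
    exacts [.inl ⟨a, ha, rfl⟩, .inr ⟨i, hi, rfl⟩]
  · rintro (⟨a, ha, rfl⟩ | ⟨i, hi, rfl⟩)
    · exact ⟨(isTube_positiveHypercubeGraph_iff _).2 (.inl ⟨a, hA.connected a ha, rfl⟩),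
        .inl ⟨a, ha, rfl⟩⟩
    · exact ⟨(isTube_positiveHypercubeGraph_iff _).2 (.inr ⟨i, rfl⟩), .inr ⟨i, hi, rfl⟩⟩

theorem singleton_inr_injective :
    Function.Injective fun i : Fin n => ({Sum.inr i} : Finset (SignedVertex n)) := fun _ _ h =>
  Sum.inr_injective (Finset.singleton_injective h)

theorem card_signedTubes {p : (_ : Finset (Finset (Fin n))) × Finset (Fin n)}
    (hp : p ∈ signedTubings G) : (signedTubes G p).card = p.1.card + p.2.card := by
  rw [← Finset.card_map (Function.Embedding.subtype _), map_signedTubes hp,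
    Finset.card_union_of_disjoint, Finset.card_image_of_injective _ positiveTube_injective,
    Finset.card_image_of_injective _ singleton_inr_injective]
  rw [Finset.disjoint_left]
  intro t ht ht'
  obtain ⟨a, -, rfl⟩ := Finset.mem_image.1 ht
  obtain ⟨i, -, hi⟩ := Finset.mem_image.1 ht'
  exact positiveTube_ne_singleton_inr a i hi.symm

theorem signedTubes_mem_tubingComplex {p : (_ : Finset (Finset (Fin n))) × Finset (Fin n)}
    (hp : p ∈ signedTubings G) : signedTubes G p ∈ tubingComplex (positiveHypercubeGraph G) := by
  obtain ⟨hA, hS⟩ := mem_signedTubings.1 hp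
  refine ⟨?_, ?_⟩
  · rintro ⟨t, ht'⟩ ht ⟨u, hu'⟩ hu htu
    rw [mem_signedTubes] at ht hu
    have hne : t ≠ u := fun h => htu (Subtype.ext h)
    dsimp only at ht hu ⊢
    rcases ht with ⟨a, ha, rfl⟩ | ⟨i, hi, rfl⟩ <;> rcases hu with ⟨b, hb, rfl⟩ | ⟨j, hj, rfl⟩
    · exact weaklyCompatible_positiveTube_iff.2 (hA.compatible a ha b hb fun h => hne (h ▸ rfl))
    · refine .inr (.inr ⟨by simp [positiveTube], fun v hv w hw hvw => ?_⟩)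
      rw [Finset.mem_singleton] at hw
      subst hw
      exact positiveHypercubeGraph_not_adj_inr v j hvw
    · refine .inr (.inr ⟨by simp [positiveTube], fun v hv w hw hvw => ?_⟩)
      rw [Finset.mem_singleton] at hv
      subst hv
      exact positiveHypercubeGraph_not_adj_inr w i hvw.symm
    · refine .inr (.inr ⟨Finset.disjoint_singleton.2 fun h => hne (congrArg _ h),
        fun v hv w hw hvw => ?_⟩)
      rw [Finset.mem_singleton] at hw
      subst hw
      exact positiveHypercubeGraph_not_adj_inr v j hvw
  · rintro i ⟨h1, h2⟩
    rw [Finset.mem_biUnion] at h1 h2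
    obtain ⟨⟨t, _⟩, ht, hit⟩ := h1
    obtain ⟨⟨u, _⟩, hu, hiu⟩ := h2
    rw [mem_signedTubes] at ht hu
    dsimp only at ht hu hit hiu
    have hcov : i ∈ covered p.1 := by
      rcases ht with ⟨a, ha, rfl⟩ | ⟨j, -, rfl⟩
      · exact mem_covered.2 ⟨a, ha, inl_mem_positiveTube.1 hit⟩
      · simp at hit
    have hneg : i ∈ p.2 := by
      rcases hu with ⟨a, -, rfl⟩ | ⟨j, hj, rfl⟩
      · exact absurd hiu inr_notMem_positiveTube
      · rw [Finset.mem_singleton] at hiu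
        exact Sum.inr_injective hiu ▸ hj
    exact hS i hneg hcov

theorem signedTubes_injOn : Set.InjOn (signedTubes G) (signedTubings G) := by
  intro p hp q hq hpq
  have h := congrArg (Finset.map (Function.Embedding.subtype _)) hpq
  rw [map_signedTubes hp, map_signedTubes hq, Finset.ext_iff] at h
  refine Sigma.ext ?_ (heq_of_eq ?_)
  · ext a
    simpa [positiveTube_injective.eq_iff, fun i => (positiveTube_ne_singleton_inr a i).symm] using
      h (positiveTube a)
  · ext i
    simpa [positiveTube_ne_singleton_inr] using h {Sum.inr i}

open scoped Classical in
theorem exists_signedTubes_eq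
    {T : Finset {t : Finset (SignedVertex n) // IsTube (positiveHypercubeGraph G) t}}
    (hT : T ∈ tubingComplex (positiveHypercubeGraph G)) :
    ∃ p ∈ signedTubings G, signedTubes G p = T := by
  obtain ⟨hT, hface⟩ := hT
  let A : Finset (Finset (Fin n)) := {a | ∃ t ∈ T, t.1 = positiveTube a}
  let S : Finset (Fin n) := {i | ∃ t ∈ T, t.1 = {Sum.inr i}}
  have hA : ∀ a, a ∈ A ↔ ∃ t ∈ T, t.1 = positiveTube a := by simp [A]
  have hS : ∀ i, i ∈ S ↔ ∃ t ∈ T, t.1 = {Sum.inr i} := by simp [S]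
  refine ⟨⟨A, S⟩, mem_signedTubings.2 ⟨⟨fun a ha => ?_, fun a ha b hb hab => ?_⟩,
    fun i hi hcov => ?_⟩, ?_⟩
  · obtain ⟨t, -, hta⟩ := (hA a).1 ha
    rcases (isTube_positiveHypercubeGraph_iff _).1 t.2 with ⟨u, hu, htu⟩ | ⟨i, hti⟩
    · rwa [positiveTube_injective (hta.symm.trans htu)]
    · exact absurd (hta.symm.trans hti) (positiveTube_ne_singleton_inr a i)
  · obtain ⟨t, ht, hta⟩ := (hA a).1 ha
    obtain ⟨u, hu, hub⟩ := (hA b).1 hb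
    have := hT t ht u hu fun h => hab (positiveTube_injective (by rw [← hta, ← hub, h]))
    rwa [hta, hub, weaklyCompatible_positiveTube_iff] at this
  · obtain ⟨t, ht, hti⟩ := (hS i).1 hi
    obtain ⟨a, ha, hia⟩ := mem_covered.1 hcov
    obtain ⟨u, hu, hua⟩ := (hA a).1 ha
    refine hface i ⟨Finset.mem_biUnion.2 ⟨u, hu, ?_⟩, Finset.mem_biUnion.2 ⟨t, ht, ?_⟩⟩
    · rw [hua]; exact inl_mem_positiveTube.2 hia
    · rw [hti]; exact Finset.mem_singleton_self _
  · ext t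
    rw [mem_signedTubes]
    constructor
    · rintro (⟨a, ha, hta⟩ | ⟨i, hi, hti⟩)
      · obtain ⟨u, hu, hua⟩ := (hA a).1 ha
        rwa [Subtype.ext (hta.trans hua.symm)]
      · obtain ⟨u, hu, hui⟩ := (hS i).1 hi
        rwa [Subtype.ext (hti.trans hui.symm)]
    · intro ht
      rcases (isTube_positiveHypercubeGraph_iff _).1 t.2 with ⟨u, -, htu⟩ | ⟨i, hti⟩
      · exact .inl ⟨u, (hA u).2 ⟨t, ht, htu⟩, htu⟩
      · exact .inr ⟨i, (hS i).2 ⟨t, ht, hti⟩, hti⟩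

open Polynomial in
/-- Each vertex that a tubing of `G` does not cover may or may not be taken as a negative vertex:
this is the weight `1 + X` of an uncovered vertex. -/
theorem tubingSum_univ_eq_sum_signedTubings (G : SimpleGraph (Fin n)) :
    tubingSum G (X : ℚ[X]) (1 + X) Finset.univ =
      ∑ p ∈ signedTubings G, X ^ (n - (p.1.card + p.2.card)) := by
  rw [signedTubings, Finset.sum_sigma, tubingSum]
  refine Finset.sum_congr rfl fun A hA => ?_
  have h1 := (mem_tubingsIn.1 hA).1.card_le
  have h2 : (Finset.univ \ covered A).card = n - (covered A).card := by
    rw [Finset.card_sdiff_of_subset (Finset.subset_univ _), Finset.card_univ, Fintype.card_fin]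
  have h3 : (covered A).card ≤ n := by simpa using Finset.card_le_univ (covered A)
  rw [Finset.card_univ, Fintype.card_fin, ← h2, ← Finset.sum_pow_mul_eq_add_pow, Finset.mul_sum]
  refine Finset.sum_congr rfl fun S hS => ?_
  have h4 := Finset.card_le_card (Finset.mem_powerset.1 hS)
  rw [one_pow, one_mul, ← pow_add]
  congr 1
  dsimp only
  omega

open Polynomial in
/-- The tubing complex of the hypercube graph is enumerated by weighted tubings of `G`. -/
theorem ncard_tubingComplex (G : SimpleGraph (Fin n)) (k : ℕ) :
    ({T | T ∈ tubingComplex (positiveHypercubeGraph G) ∧ T.card + k = n}.ncard : ℚ) =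
      (tubingSum G (X : ℚ[X]) (1 + X) Finset.univ).coeff k := by
  have hle : ∀ p ∈ signedTubings G, p.1.card + p.2.card ≤ n := by
    intro p hp
    obtain ⟨hA, hS⟩ := mem_signedTubings.1 hp
    have h := hA.card_le
    have hd : Disjoint p.2 (covered p.1) := Finset.disjoint_left.2 hS
    have h' := Finset.card_le_univ (p.2 ∪ covered p.1)
    rw [Finset.card_union_of_disjoint hd, Fintype.card_fin] at h'
    omega
  rw [tubingSum_univ_eq_sum_signedTubings, finsetSum_coeff]
  simp only [coeff_X_pow]
  rw [Finset.sum_boole, ← Set.ncard_coe_finset]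
  congr 1
  symm
  refine Set.ncard_congr (fun p _ => signedTubes G p) ?_ ?_ ?_
  · intro p hp
    obtain ⟨hp, hk⟩ := Finset.mem_filter.1 (Finset.mem_coe.1 hp)
    refine ⟨signedTubes_mem_tubingComplex hp, ?_⟩
    have := hle p hp
    rw [card_signedTubes hp]
    omega
  · intro p q hp hq h
    exact signedTubes_injOn (Finset.mem_filter.1 (Finset.mem_coe.1 hp)).1
      (Finset.mem_filter.1 (Finset.mem_coe.1 hq)).1 h
  · rintro T ⟨hT, hk⟩
    obtain ⟨p, hp, rfl⟩ := exists_signedTubes_eq hT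
    rw [card_signedTubes hp] at hk
    exact ⟨p, Finset.mem_coe.2 (Finset.mem_filter.2 ⟨hp, by omega⟩), rfl⟩

theorem IsHalohedron.faceCount_eq {P : Set (EuclideanSpace ℝ (Fin n))} (hP : IsHalohedron P)
    (k : ℕ) : (faceCount P k : ℚ) = (PowerSeries.coeff n
      (cycleSeries (Polynomial.X : Polynomial ℚ) (1 + Polynomial.X))).coeff k := by
  rw [cycleSeries, PowerSeries.coeff_mk, ← ncard_tubingComplex, hP.1.faceCount_eq hP.2,
    finrank_euclideanSpace_fin]
  rfl

end Hypercube

/-! ### Bivariate power series -/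

section Bivariate

/-- A power series in `y` with coefficients in `ℚ[x]`, as a power series in `x = X 0` and
`y = X 1`. -/
noncomputable def toBivariateFun (F : PowerSeries (Polynomial ℚ)) : MvPowerSeries (Fin 2) ℚ :=
  fun m => (PowerSeries.coeff (m 1) F).coeff (m 0)

theorem coeff_toBivariateFun (F : PowerSeries (Polynomial ℚ)) (m : Fin 2 →₀ ℕ) :
    MvPowerSeries.coeff m (toBivariateFun F) = (PowerSeries.coeff (m 1) F).coeff (m 0) := rfl

theorem finsupp_fin_two_ext {m m' : Fin 2 →₀ ℕ} : m = m' ↔ m 0 = m' 0 ∧ m 1 = m' 1 := by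
  rw [Finsupp.ext_iff, Fin.forall_fin_two]

theorem toBivariateFun_one : toBivariateFun 1 = 1 := by
  classical
  ext m
  rw [coeff_toBivariateFun, PowerSeries.coeff_one, MvPowerSeries.coeff_one]
  by_cases h1 : m 1 = 0 <;> by_cases h0 : m 0 = 0 <;>
    simp [h0, h1, finsupp_fin_two_ext, Polynomial.coeff_one]

theorem toBivariateFun_mul (F F' : PowerSeries (Polynomial ℚ)) :
    toBivariateFun (F * F') = toBivariateFun F * toBivariateFun F' := by
  classical
  ext m
  simp only [MvPowerSeries.coeff_mul, coeff_toBivariateFun, PowerSeries.coeff_mul,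
    Polynomial.finsetSum_coeff, Polynomial.coeff_mul, Finset.sum_sigma']
  symm
  refine Finset.sum_bij (fun p _ => ⟨(p.1 1, p.2 1), (p.1 0, p.2 0)⟩) ?_ ?_ ?_ ?_
  · intro p hp
    rw [Finset.HasAntidiagonal.mem_antidiagonal] at hp
    subst hp
    simp
  · intro p _ q _ h
    simp only [Sigma.mk.injEq, Prod.mk.injEq, heq_eq_eq] at h
    exact Prod.ext (finsupp_fin_two_ext.2 ⟨h.2.1, h.1.1⟩) (finsupp_fin_two_ext.2 ⟨h.2.2, h.1.2⟩)
  · rintro ⟨⟨i, j⟩, ⟨k, l⟩⟩ h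
    simp only [Finset.mem_sigma, Finset.HasAntidiagonal.mem_antidiagonal] at h
    refine ⟨(Finsupp.equivFunOnFinite.symm ![k, i], Finsupp.equivFunOnFinite.symm ![l, j]), ?_, ?_⟩
    · rw [Finset.HasAntidiagonal.mem_antidiagonal, finsupp_fin_two_ext]
      simpa using h.symm
    · simp
  · intro _ _
    rfl

/-- The embedding of `ℚ[x]⟦y⟧` into the ring of power series in `x = X 0` and `y = X 1`. -/
noncomputable def toBivariate : PowerSeries (Polynomial ℚ) →+* MvPowerSeries (Fin 2) ℚ where
  toFun := toBivariateFun
  map_zero' := by ext m; simp [coeff_toBivariateFun]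
  map_add' F F' := by ext m; simp [coeff_toBivariateFun]
  map_one' := toBivariateFun_one
  map_mul' := toBivariateFun_mul

theorem coeff_toBivariate (F : PowerSeries (Polynomial ℚ)) (m : Fin 2 →₀ ℕ) :
    MvPowerSeries.coeff m (toBivariate F) = (PowerSeries.coeff (m 1) F).coeff (m 0) := rfl

theorem toBivariate_C_X : toBivariate (PowerSeries.C Polynomial.X) = MvPowerSeries.X 0 := by
  classical
  ext m
  rw [coeff_toBivariate, PowerSeries.coeff_C, MvPowerSeries.coeff_X]
  by_cases h1 : m 1 = 0 <;>
    simp [h1, finsupp_fin_two_ext, Polynomial.coeff_X, eq_comm (a := 1)]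

theorem toBivariate_X : toBivariate PowerSeries.X = MvPowerSeries.X 1 := by
  classical
  ext m
  rw [coeff_toBivariate, PowerSeries.coeff_X, MvPowerSeries.coeff_X]
  by_cases h1 : m 1 = 1 <;> by_cases h0 : m 0 = 0 <;>
    simp [h0, h1, finsupp_fin_two_ext, Polynomial.coeff_one]

theorem bivariateFPolynomial_eq {P : (n : ℕ) → Set (EuclideanSpace ℝ (Fin n))}
    (hP : ∀ n, IsHalohedron (P n)) :
    bivariateFPolynomial P = toBivariate (cycleSeries Polynomial.X (1 + Polynomial.X)) := by
  ext m
  rw [coeff_toBivariate, ← (hP (m 1)).faceCount_eq]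
  rfl

theorem vertexGeneratingFunction_eq {P : (n : ℕ) → Set (EuclideanSpace ℝ (Fin n))}
    (hP : ∀ n, IsHalohedron (P n)) :
    vertexGeneratingFunction P = PowerSeries.map (Polynomial.evalRingHom 0)
      (cycleSeries Polynomial.X (1 + Polynomial.X)) := by
  ext n
  rw [PowerSeries.coeff_map, Polynomial.coe_evalRingHom, ← Polynomial.coeff_zero_eq_eval_zero,
    ← (hP n).faceCount_eq, vertexGeneratingFunction, PowerSeries.coeff_mk]

end Bivariate

/-! ### The generating function of the halohedra -/

theorem mainTheorem1 (P : (n : ℕ) → Set (EuclideanSpace ℝ (Fin n)))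
    (hP : ∀ n, IsHalohedron (P n)) :
    (∃ S : MvPowerSeries (Fin 2) ℚ,
      S ^ 2 = 1 - 2 * (2 + MvPowerSeries.X 0) * MvPowerSeries.X 1
          + MvPowerSeries.X 0 ^ 2 * MvPowerSeries.X 1 ^ 2 ∧
      MvPowerSeries.constantCoeff S = 1 ∧
      bivariateFPolynomial P =
        (1 + (2 + MvPowerSeries.X 0) * MvPowerSeries.X 1) * (2 * S)⁻¹
          + MvPowerSeries.C (1 / 2)) ∧
    (∃ S : PowerSeries ℚ,
      S ^ 2 = 1 - 4 * PowerSeries.X ∧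
      PowerSeries.constantCoeff S = 1 ∧
      vertexGeneratingFunction P =
        (1 + 2 * PowerSeries.X) * (2 * S)⁻¹ + PowerSeries.C (1 / 2)) := by
  have hsq := rootSeries_sq (R := Polynomial ℚ) Polynomial.X_ne_zero
  have hgf := two_mul_cycleSeries_mul_rootSeries (R := Polynomial ℚ) Polynomial.X_ne_zero
  have hc := constantCoeff_rootSeries (Polynomial.X : Polynomial ℚ)
  constructor
  · have hS : MvPowerSeries.constantCoeff (toBivariate (rootSeries Polynomial.X)) = 1 := by
      rw [← MvPowerSeries.coeff_zero_eq_constantCoeff_apply, coeff_toBivariate]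
      simp [hc]
    refine ⟨toBivariate (rootSeries Polynomial.X), ?_, hS, ?_⟩
    · rw [← map_pow, hsq]
      simp only [map_add, map_sub, map_mul, map_pow, map_one, map_ofNat, toBivariate_C_X,
        toBivariate_X]
    · have h := congrArg toBivariate hgf
      simp only [map_add, map_mul, map_one, map_ofNat, toBivariate_C_X, toBivariate_X,
        ← bivariateFPolynomial_eq hP] at h
      set S := toBivariate (rootSeries Polynomial.X)
      have hinv : (2 * S) * (2 * S)⁻¹ = 1 := MvPowerSeries.mul_inv_cancel _ 
        (by rw [map_mul, map_ofNat, hS]; norm_num)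
      have hhalf : (MvPowerSeries.C (1 / 2) : MvPowerSeries (Fin 2) ℚ) * 2 = 1 := by
        rw [← map_ofNat (MvPowerSeries.C (σ := Fin 2) (R := ℚ)) 2, ← map_mul]
        norm_num
      linear_combination (2 * S)⁻¹ * h + (MvPowerSeries.C (1 / 2) - bivariateFPolynomial P) * hinv -
        S * (2 * S)⁻¹ * hhalf
  · have hS : PowerSeries.constantCoeff
        (PowerSeries.map (Polynomial.evalRingHom 0) (rootSeries (Polynomial.X : Polynomial ℚ))) =
        1 := by
      rw [← PowerSeries.coeff_zero_eq_constantCoeff_apply, PowerSeries.coeff_map,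
        PowerSeries.coeff_zero_eq_constantCoeff_apply, hc, map_one]
    have hX : PowerSeries.map (Polynomial.evalRingHom 0)
        (PowerSeries.C (Polynomial.X : Polynomial ℚ)) = 0 := by simp
    refine ⟨PowerSeries.map (Polynomial.evalRingHom 0) (rootSeries Polynomial.X), ?_, hS, ?_⟩
    · rw [← map_pow, hsq]
      simp only [map_add, map_sub, map_mul, map_pow, map_one, map_ofNat, hX, PowerSeries.map_X]
      ring
    · have h := congrArg (PowerSeries.map (Polynomial.evalRingHom 0)) hgf
      simp only [map_add (PowerSeries.map _), map_mul, map_one (PowerSeries.map _), map_ofNat, hX,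
        PowerSeries.map_X, ← vertexGeneratingFunction_eq hP] at h
      set S := PowerSeries.map (Polynomial.evalRingHom 0) (rootSeries (Polynomial.X : Polynomial ℚ))
      have hinv : (2 * S) * (2 * S)⁻¹ = 1 := PowerSeries.mul_inv_cancel _ 
        (by rw [map_mul, map_ofNat, hS]; norm_num)
      have hhalf : (PowerSeries.C (1 / 2) : PowerSeries ℚ) * 2 = 1 := by
        rw [← map_ofNat (PowerSeries.C (R := ℚ)) 2, ← map_mul]
        norm_num
      linear_combination (2 * S)⁻¹ * h + (PowerSeries.C (1 / 2) - vertexGeneratingFunction P) *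
        hinv - S * (2 * S)⁻¹ * hhalf
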